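/- Let $p\ge 2$ be an integer, $\mathfrak q=e^{i\pi/p}$ and $[n]=\frac{\mathfrak q^n-\mathfrak q^{-n}}{\mathfrak q-\mathfrak q^{-1}}$. Let $\overline{\mathcal U}_{\mathfrak q}s\ell(2)$ be the Hopf algebra over $\mathbb C$ generated by $E,F,K$ with relations $$E^p=F^p=0,\quad K^{2p}=1,\quad KEK^{-1}=\mathfrak q^2E,\quad KFK^{-1}=\mathfrak q^{-2}F,\quad [E,F]=\frac{K-K^{-1}}{\mathfrak q-\mathfrak q^{-1}},$$ comultiplication $\Delta(E)=1\otimes E+E\otimes K$, $\Delta(F)=K^{-1}\otimes F+F\otimes 1$, $\Delta(K)=K\otimes K$, counit $\epsilon(E)=\epsilon(F)=0$, $\epsilon(K)=1$, and antipode $S(E)=-EK^{-1}$, $S(F)=-KF$, $S(K)=K^{-1}$. For $\alpha=\pm1$ and $1\le s\le p$ let $\mathscr X^{\alpha}(s)$ be the $s$-dimensional representation with basis $v_0,\dots,v_{s-1}$ and action $$Kv_n=\alpha\,\mathfrak q^{s-1-2n}v_n,\qquad Ev_n=\alpha\,[n][s-n]\,v_{n-1},\qquad Fv_n=v_{n+1}\qquad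 (v_{-1}=v_s=0).$$ The $2p$ representations $\mathscr X^{\alpha}(s)$ are irreducible and pairwise non-isomorphic, and every irreducible finite-dimensional representation is isomorphic to one of them. Let the Grothendieck ring be the abelian group generated by the classes of finite-dimensional representations, with the relations $[N]=[M]+[P]$ for all short exact sequences $0\to M\to N\to P\to 0$ and with the product $[M][N]=[M\otimes N]$. The classes of the $\mathscr X^{\alpha}(s)$ (denoted by the same symbols) form a $\mathbb Z$-basis of it, and its multiplication is given by $$\mathscr X^{\alpha}(s)\,\mathscr X^{\alpha'}(s')=\sum_{\substack{s''=|s-s'|+1\\ \mathrm{step}=2}}^{s+s'-1}\widetilde{\mathscr X}^{\alpha\alpha'}(s''),$$ where $$\widetilde{\mathscr X}^{\alpha}(s)=\begin{cases}\mathscr X^{\alpha}(s),&1\le s\le p,\\ \mathscr X^{\alpha}(2p-s)+2\mathscr X^{-\alpha}(s-p),&p+1\le s\le 2p-1.\end{cases}$$ Consequently, let the $(1,p)$ fusion algebra be the free abelian group on the $2p$ symbols $\chi^{\alpha}(s)$ ($\alpha=\pm1$, $1\le s\le p$) with the bilinear product $$\chi^{\alpha}(s)\,\chi^{\alpha'}(s')=\sum_{\substack{s''=|s-s'|+1\\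 \mathrm{step}=2}}^{s+s'-1}\widetilde\chi^{\alpha\alpha'}(s''),\qquad \widetilde\chi^{\alpha}(s)=\begin{cases}\chi^{\alpha}(s),&1\le s\le p,\\ \chi^{\alpha}(2p-s)+2\chi^{-\alpha}(s-p),&p+1\le s\le 2p-1.\end{cases}$$ Then there is a ring isomorphism from the $(1,p)$ fusion algebra to the Grothendieck ring of $\overline{\mathcal U}_{\mathfrak q}s\ell(2)$ that maps $\chi^{\alpha}(s)$ to $\mathscr X^{\alpha}(s)$ for all $\alpha=\pm1$ and $s=1,\dots,p$; that is, the two coincide together with their preferred bases. -/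

import Mathlib

open scoped TensorProduct

namespace RestrictedQuantum

section QuantumNumbers

/-- The primitive `2p`-th root of unity `𝔮 = exp(iπ/p)`. -/
noncomputable def q (p : ℕ) : ℂ := Complex.exp (Complex.I * Real.pi / p)

/-- The quantum integer `[n] = (𝔮ⁿ - 𝔮⁻ⁿ) / (𝔮 - 𝔮⁻¹)`. -/
noncomputable def qInt (p : ℕ) (n : ℤ) : ℂ :=
  (q p ^ n - q p ^ (-n)) / (q p - (q p)⁻¹)

variable (p : ℕ)

theorem q_ne_zero : q p ≠ 0 := Complex.exp_ne_zero _

variable [hp : p.AtLeastTwo]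

theorem q_prim : IsPrimitiveRoot (q p) (2 * p) := by
  have h2 := hp.prop
  have h := Complex.isPrimitiveRoot_exp (2 * p) (by omega)
  have e : q p = Complex.exp (2 * Real.pi * Complex.I / ((2 * p : ℕ) : ℂ)) := by
    have : (p : ℂ) ≠ 0 := by exact_mod_cast (by omega : p ≠ 0)
    unfold q
    congr 1
    push_cast
    field_simp
  rw [e]
  exact h

theorem q_sq_prim : IsPrimitiveRoot (q p ^ 2) p :=
  (q_prim p).pow (by have := hp.prop; omega) rfl

theorem q_pow_two_p : q p ^ (2 * p) = 1 := (q_prim p).pow_eq_one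

theorem q_sub_inv_ne_zero : q p - (q p)⁻¹ ≠ 0 := by
  have h2 := hp.prop
  have h0 := q_ne_zero p
  intro h
  have h1 : q p ^ 2 = 1 := by
    have : q p * (q p - (q p)⁻¹) = 0 := by rw [h, mul_zero]
    rw [mul_sub, mul_inv_cancel₀ h0] at this
    rw [pow_two]
    exact sub_eq_zero.mp this
  have := (q_sq_prim p).dvd_of_pow_eq_one 1 (by simpa using h1)
  have := Nat.le_of_dvd one_pos this
  omega

end QuantumNumbers

section QBinomial

/-- Gaussian binomial coefficients, through the recursion they satisfy. -/
def gaussBinom {R : Type*} [CommRing R] (Q : R) : ℕ → ℕ → R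
  | _, 0 => 1
  | 0, _ + 1 => 0
  | n + 1, k + 1 => gaussBinom Q n k + Q ^ (k + 1) * gaussBinom Q n (k + 1)

theorem gaussBinom_zero_right {R : Type*} [CommRing R] (Q : R) (n : ℕ) :
    gaussBinom Q n 0 = 1 := by
  cases n <;> rfl

theorem gaussBinom_of_lt {R : Type*} [CommRing R] (Q : R) :
    ∀ {n k : ℕ}, n < k → gaussBinom Q n k = 0
  | 0, _ + 1, _ => rfl
  | n + 1, k + 1, h => by
    have h1 : n < k := by omega
    rw [gaussBinom, gaussBinom_of_lt Q h1, gaussBinom_of_lt Q (Nat.lt_succ_of_lt h1)]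
    ring

theorem gaussBinom_absorb {R : Type*} [CommRing R] (Q : R) :
    ∀ n k : ℕ, gaussBinom Q (n + 1) (k + 1) * (Q ^ (k + 1) - 1)
      = gaussBinom Q n k * (Q ^ (n + 1) - 1) := by
  intro n
  induction n with
  | zero =>
    intro k
    cases k with
    | zero => simp [gaussBinom]
    | succ k => simp [gaussBinom]
  | succ n ih =>
    intro k
    have h1 : gaussBinom Q (n + 2) (k + 1)
        = gaussBinom Q (n + 1) k + Q ^ (k + 1) * gaussBinom Q (n + 1) (k + 1) := rfl
    rw [h1, add_mul, mul_assoc, ih k]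
    cases k with
    | zero => simp only [gaussBinom_zero_right]; ring
    | succ j =>
      have h2 : gaussBinom Q (n + 1) (j + 1)
        = gaussBinom Q n j + Q ^ (j + 1) * gaussBinom Q n (j + 1) := rfl
      have h3 := ih j
      rw [show n + 1 + 1 = (n + 1) + 1 from rfl]
      linear_combination (exp := 1) Q * h3 - Q * (Q ^ (n + 1) - 1) * h2

theorem add_pow_of_qcomm {R B : Type*} [CommRing R] [Ring B] [Algebra R B] (Q : R) {x y : B}
    (h : y * x = Q • (x * y)) (n : ℕ) :
    (x + y) ^ n = ∑ k ∈ Finset.range (n + 1), gaussBinom Q n k • (x ^ k * y ^ (n - k)) := by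
  have hk : ∀ k : ℕ, y * x ^ k = Q ^ k • (x ^ k * y) := by
    intro k
    induction k with
    | zero => simp
    | succ k ih =>
      rw [pow_succ, ← mul_assoc, ih, smul_mul_assoc, mul_assoc, h, mul_smul_comm, smul_smul,
        ← mul_assoc, ← pow_succ]
  induction n with
  | zero => simp [gaussBinom]
  | succ n ih =>
    rw [pow_succ', ih, add_mul, Finset.mul_sum, Finset.mul_sum, Finset.sum_range_succ' _ (n + 1)]
    have e1 : ∀ k ∈ Finset.range (n + 1),
        gaussBinom Q (n + 1) (k + 1) • (x ^ (k + 1) * y ^ (n + 1 - (k + 1)))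
          = x * gaussBinom Q n k • (x ^ k * y ^ (n - k))
            + (Q ^ (k + 1) * gaussBinom Q n (k + 1)) • (x ^ (k + 1) * y ^ (n - k)) := by
      intro k _
      rw [gaussBinom, add_smul, mul_smul_comm, ← mul_assoc, ← pow_succ', Nat.succ_sub_succ]
    have e2 : ∀ k ∈ Finset.range (n + 1), y * gaussBinom Q n k • (x ^ k * y ^ (n - k))
        = (Q ^ k * gaussBinom Q n k) • (x ^ k * y ^ (n + 1 - k)) := by
      intro k hk'
      rw [mul_smul_comm, ← mul_assoc, hk, smul_mul_assoc, smul_smul, mul_assoc, ← pow_succ',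
        mul_comm, Nat.succ_sub (Nat.lt_succ_iff.mp (Finset.mem_range.mp hk'))]
    rw [Finset.sum_congr rfl e1, Finset.sum_congr rfl e2, Finset.sum_add_distrib, add_assoc]
    congr 1
    rw [Finset.sum_range_succ' _ n, Finset.sum_range_succ _ n,
      gaussBinom_of_lt Q (Nat.lt_succ_self n)]
    simp [gaussBinom_zero_right]

theorem add_pow_eq_zero {B : Type*} [Ring B] [Algebra ℂ B] {Q : ℂ} {p : ℕ} (hp : 0 < p)
    (hQ : IsPrimitiveRoot Q p) {x y : B} (h : y * x = Q • (x * y)) (hx : x ^ p = 0)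
    (hy : y ^ p = 0) : (x + y) ^ p = 0 := by
  rw [add_pow_of_qcomm Q h]
  refine Finset.sum_eq_zero fun k hk => ?_
  rcases Nat.eq_zero_or_pos k with rfl | h0
  · simp [hy]
  rcases (Nat.lt_succ_iff.mp (Finset.mem_range.mp hk)).eq_or_lt with rfl | h1
  · simp [hx]
  obtain ⟨k, rfl⟩ : ∃ j, k = j + 1 := ⟨k - 1, by omega⟩
  obtain ⟨n, rfl⟩ : ∃ j, p = j + 1 := ⟨p - 1, by omega⟩
  have h2 := gaussBinom_absorb Q n k
  rw [hQ.pow_eq_one, sub_self, mul_zero] at h2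
  have h3 : Q ^ (k + 1) - 1 ≠ 0 := sub_ne_zero.mpr (hQ.pow_ne_one_of_pos_of_lt (by omega) h1)
  rw [(mul_eq_zero.mp h2).resolve_right h3, zero_smul]

end QBinomial

section Algebra

/-- The generators of the restricted quantum group. -/
inductive Gen
  | E
  | F
  | K

/-- The defining relations of the restricted quantum group (`K⁻¹` is `K ^ (2p - 1)`). -/
inductive Rel (p : ℕ) : FreeAlgebra ℂ Gen → FreeAlgebra ℂ Gen → Prop
  | E_pow : Rel p (FreeAlgebra.ι ℂ Gen.E ^ p) 0
  | F_pow : Rel p (FreeAlgebra.ι ℂ Gen.F ^ p) 0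
  | K_pow : Rel p (FreeAlgebra.ι ℂ Gen.K ^ (2 * p)) 1
  | KE : Rel p
      (FreeAlgebra.ι ℂ Gen.K * FreeAlgebra.ι ℂ Gen.E * FreeAlgebra.ι ℂ Gen.K ^ (2 * p - 1))
      (q p ^ 2 • FreeAlgebra.ι ℂ Gen.E)
  | KF : Rel p
      (FreeAlgebra.ι ℂ Gen.K * FreeAlgebra.ι ℂ Gen.F * FreeAlgebra.ι ℂ Gen.K ^ (2 * p - 1))
      ((q p ^ 2)⁻¹ • FreeAlgebra.ι ℂ Gen.F)
  | EF : Rel p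
      (FreeAlgebra.ι ℂ Gen.E * FreeAlgebra.ι ℂ Gen.F
        - FreeAlgebra.ι ℂ Gen.F * FreeAlgebra.ι ℂ Gen.E)
      ((q p - (q p)⁻¹)⁻¹ • (FreeAlgebra.ι ℂ Gen.K - FreeAlgebra.ι ℂ Gen.K ^ (2 * p - 1)))

/-- The restricted quantum group `Ū_𝔮 sl(2)` at `𝔮 = exp(iπ/p)`, as an algebra. -/
def Uq (p : ℕ) : Type := RingQuot (Rel p)

noncomputable instance (p : ℕ) : Ring (Uq p) := inferInstanceAs (Ring (RingQuot (Rel p)))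

noncomputable instance (p : ℕ) : Algebra ℂ (Uq p) :=
  inferInstanceAs (Algebra ℂ (RingQuot (Rel p)))

namespace Uq

variable (p : ℕ)

/-- The projection from the free algebra. -/
noncomputable def mk : FreeAlgebra ℂ Gen →ₐ[ℂ] Uq p := RingQuot.mkAlgHom ℂ (Rel p)

/-- The generator `E`. -/
noncomputable def E : Uq p := mk p (FreeAlgebra.ι ℂ Gen.E)
/-- The generator `F`. -/
noncomputable def F : Uq p := mk p (FreeAlgebra.ι ℂ Gen.F)
/-- The generator `K`. -/
noncomputable def K : Uq p := mk p (FreeAlgebra.ι ℂ Gen.K)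
/-- The inverse of the generator `K`. -/
noncomputable def Kinv : Uq p := K p ^ (2 * p - 1)

end Uq

/-- Three elements of an algebra that satisfy the defining relations. -/
structure IsTriple (p : ℕ) {B : Type*} [Ring B] [Algebra ℂ B] (e f k : B) : Prop where
  e_pow : e ^ p = 0
  f_pow : f ^ p = 0
  k_pow : k ^ (2 * p) = 1
  ke : k * e * k ^ (2 * p - 1) = q p ^ 2 • e
  kf : k * f * k ^ (2 * p - 1) = (q p ^ 2)⁻¹ • f
  ef : e * f - f * e = (q p - (q p)⁻¹)⁻¹ • (k - k ^ (2 * p - 1))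

theorem Uq.mk_rel {p : ℕ} {x y : FreeAlgebra ℂ Gen} (h : Rel p x y) : Uq.mk p x = Uq.mk p y :=
  RingQuot.mkAlgHom_rel ℂ h

theorem Uq.isTriple (p : ℕ) : IsTriple p (Uq.E p) (Uq.F p) (Uq.K p) where
  e_pow := by
    simpa [Uq.E] using Uq.mk_rel (Rel.E_pow (p := p))
  f_pow := by
    simpa [Uq.F] using Uq.mk_rel (Rel.F_pow (p := p))
  k_pow := by
    simpa [Uq.K] using Uq.mk_rel (Rel.K_pow (p := p))
  ke := by
    simpa [Uq.K, Uq.E] using Uq.mk_rel (Rel.KE (p := p))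
  kf := by
    simpa [Uq.K, Uq.F] using Uq.mk_rel (Rel.KF (p := p))
  ef := by
    simpa [Uq.K, Uq.F, Uq.E] using Uq.mk_rel (Rel.EF (p := p))

/-- The assignment of the generators that sends `E, F, K` to `e, f, k`. -/
def genFun {B : Type*} (e f k : B) : Gen → B
  | Gen.E => e
  | Gen.F => f
  | Gen.K => k

/-- The universal property of the restricted quantum group. -/
noncomputable def Uq.lift {p : ℕ} {B : Type*} [Ring B] [Algebra ℂ B] {e f k : B}
    (h : IsTriple p e f k) : Uq p →ₐ[ℂ] B :=
  RingQuot.liftAlgHom ℂ ⟨FreeAlgebra.lift ℂ (genFun e f k), by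
    intro x y hxy
    cases hxy with
    | E_pow => simpa [genFun] using h.e_pow
    | F_pow => simpa [genFun] using h.f_pow
    | K_pow => simpa [genFun] using h.k_pow
    | KE => simpa [genFun] using h.ke
    | KF => simpa [genFun] using h.kf
    | EF => simpa [genFun] using h.ef⟩

section lift
variable {p : ℕ} {B : Type*} [Ring B] [Algebra ℂ B] {e f k : B} (h : IsTriple p e f k)

theorem Uq.lift_mk (x : FreeAlgebra ℂ Gen) :
    Uq.lift h (Uq.mk p x) = FreeAlgebra.lift ℂ (genFun e f k) x :=
  RingQuot.liftAlgHom_mkAlgHom_apply ..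

@[simp] theorem Uq.lift_E : Uq.lift h (Uq.E p) = e := by
  rw [Uq.E, Uq.lift_mk]; simp [genFun]
@[simp] theorem Uq.lift_F : Uq.lift h (Uq.F p) = f := by
  rw [Uq.F, Uq.lift_mk]; simp [genFun]
@[simp] theorem Uq.lift_K : Uq.lift h (Uq.K p) = k := by
  rw [Uq.K, Uq.lift_mk]; simp [genFun]
@[simp] theorem Uq.lift_Kinv : Uq.lift h (Uq.Kinv p) = k ^ (2 * p - 1) := by
  rw [Uq.Kinv, map_pow, Uq.lift_K]

theorem Uq.algHom_ext {φ ψ : Uq p →ₐ[ℂ] B} (hE : φ (Uq.E p) = ψ (Uq.E p))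
    (hF : φ (Uq.F p) = ψ (Uq.F p)) (hK : φ (Uq.K p) = ψ (Uq.K p)) : φ = ψ := by
  apply RingQuot.ringQuot_ext' ℂ
  apply FreeAlgebra.hom_ext
  funext g
  cases g with
  | E => exact hE
  | F => exact hF
  | K => exact hK

/-- Induction on elements of the restricted quantum group. -/
theorem Uq.induction {C : Uq p → Prop} (hc : ∀ c : ℂ, C (algebraMap ℂ _ c))
    (hadd : ∀ a b, C a → C b → C (a + b)) (hmul : ∀ a b, C a → C b → C (a * b))
    (hE : C (Uq.E p)) (hF : C (Uq.F p)) (hK : C (Uq.K p)) (x : Uq p) : C x := by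
  obtain ⟨y, rfl⟩ := RingQuot.mkAlgHom_surjective ℂ (Rel p) x
  change C (Uq.mk p y)
  induction y using FreeAlgebra.induction with
  | grade0 r => rw [AlgHom.commutes]; exact hc r
  | grade1 g =>
    cases g with
    | E => exact hE
    | F => exact hF
    | K => exact hK
  | mul a b ha hb => rw [map_mul]; exact hmul _ _ ha hb
  | add a b ha hb => rw [map_add]; exact hadd _ _ ha hb

end lift

theorem Uq.E_mul_F (p : ℕ) :
    Uq.E p * Uq.F p = Uq.F p * Uq.E p + (q p - (q p)⁻¹)⁻¹ • (Uq.K p - Uq.Kinv p) := by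
  rw [← sub_eq_iff_eq_add']
  exact (Uq.isTriple p).ef

section relations
variable (p : ℕ) [hp : p.AtLeastTwo]

theorem two_p_pred : 2 * p = (2 * p - 1) + 1 := by
  have := hp.prop
  omega

/-- Constructor of triples from the relations in which `K⁻¹` is a given element. -/
theorem IsTriple.of_inv {p : ℕ} [hp : p.AtLeastTwo] {B : Type*} [Ring B] [Algebra ℂ B]
    {e f k k' : B} (e_pow : e ^ p = 0) (f_pow : f ^ p = 0) (k_pow : k ^ (2 * p) = 1)
    (hk : k * k' = 1) (ke : k * e = q p ^ 2 • (e * k)) (kf : f * k = q p ^ 2 • (k * f))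
    (ef : e * f - f * e = (q p - (q p)⁻¹)⁻¹ • (k - k')) : IsTriple p e f k := by
  have h1 : k ^ (2 * p - 1) * k = 1 := by rw [← pow_succ, ← two_p_pred, k_pow]
  have h2 : k ^ (2 * p - 1) = k' := left_inv_eq_right_inv h1 hk
  have hq : q p ^ 2 ≠ 0 := pow_ne_zero _ (q_ne_zero p)
  refine ⟨e_pow, f_pow, k_pow, ?_, ?_, ?_⟩
  · rw [h2, ke, smul_mul_assoc, mul_assoc, hk, mul_one]
  · have : k * f = (q p ^ 2)⁻¹ • (f * k) := by rw [kf, smul_smul, inv_mul_cancel₀ hq, one_smul]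
    rw [h2, this, smul_mul_assoc, mul_assoc, hk, mul_one]
  · rw [h2, ef]

namespace Uq

theorem K_mul_Kinv : K p * Kinv p = 1 := by
  rw [Kinv, ← pow_succ', ← two_p_pred, (isTriple p).k_pow]

theorem Kinv_mul_K : Kinv p * K p = 1 := by
  rw [Kinv, ← pow_succ, ← two_p_pred, (isTriple p).k_pow]

theorem K_mul_E : K p * E p = q p ^ 2 • (E p * K p) := by
  have h := (isTriple p).ke
  rw [show K p ^ (2 * p - 1) = Kinv p from rfl] at h
  rw [← smul_mul_assoc, ← h, mul_assoc, Kinv_mul_K, mul_one]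

theorem F_mul_K : F p * K p = q p ^ 2 • (K p * F p) := by
  have h := (isTriple p).kf
  have hq : q p ^ 2 ≠ 0 := pow_ne_zero _ (q_ne_zero p)
  rw [show K p ^ (2 * p - 1) = Kinv p from rfl] at h
  have h2 : K p * F p = (q p ^ 2)⁻¹ • (F p * K p) := by
    rw [← smul_mul_assoc, ← h, mul_assoc, Kinv_mul_K, mul_one]
  rw [h2, smul_smul, mul_inv_cancel₀ hq, one_smul]

theorem E_mul_Kinv : E p * Kinv p = q p ^ 2 • (Kinv p * E p) := by
  calc E p * Kinv p = Kinv p * (K p * E p) * Kinv p := by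
        rw [← mul_assoc, Kinv_mul_K, one_mul]
    _ = q p ^ 2 • (Kinv p * E p * (K p * Kinv p)) := by
        rw [K_mul_E, mul_smul_comm, smul_mul_assoc]; simp only [mul_assoc]
    _ = _ := by rw [K_mul_Kinv, mul_one]

theorem Kinv_mul_F : Kinv p * F p = q p ^ 2 • (F p * Kinv p) := by
  calc Kinv p * F p = Kinv p * (F p * K p) * Kinv p := by
        rw [mul_assoc, mul_assoc, K_mul_Kinv, mul_one]
    _ = q p ^ 2 • ((Kinv p * K p) * F p * Kinv p) := by
        rw [F_mul_K, mul_smul_comm, smul_mul_assoc]; simp only [mul_assoc]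
    _ = _ := by rw [Kinv_mul_K, one_mul]

/-- The images of the generators under the comultiplication satisfy the relations. -/
theorem isTriple_comul :
    IsTriple p (1 ⊗ₜ[ℂ] E p + E p ⊗ₜ[ℂ] K p) (Kinv p ⊗ₜ[ℂ] F p + F p ⊗ₜ[ℂ] 1)
      (K p ⊗ₜ[ℂ] K p) := by
  have h2 := hp.prop
  have hT := isTriple p
  refine IsTriple.of_inv (k' := Kinv p ⊗ₜ[ℂ] Kinv p) ?_ ?_ ?_ ?_ ?_ ?_ ?_
  · refine add_pow_eq_zero (by omega) (q_sq_prim p) ?_ ?_ ?_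
    · simp only [Algebra.TensorProduct.tmul_mul_tmul, one_mul, mul_one, K_mul_E,
        TensorProduct.tmul_smul]
    · rw [Algebra.TensorProduct.tmul_pow, hT.e_pow, TensorProduct.tmul_zero]
    · rw [Algebra.TensorProduct.tmul_pow, hT.e_pow, TensorProduct.zero_tmul]
  · rw [add_comm]
    refine add_pow_eq_zero (by omega) (q_sq_prim p) ?_ ?_ ?_
    · simp only [Algebra.TensorProduct.tmul_mul_tmul, one_mul, mul_one, Kinv_mul_F,
        ← TensorProduct.smul_tmul']
    · rw [Algebra.TensorProduct.tmul_pow, hT.f_pow, TensorProduct.zero_tmul]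
    · rw [Algebra.TensorProduct.tmul_pow, hT.f_pow, TensorProduct.tmul_zero]
  · rw [Algebra.TensorProduct.tmul_pow, hT.k_pow, Algebra.TensorProduct.one_def]
  · rw [Algebra.TensorProduct.tmul_mul_tmul, K_mul_Kinv, Algebra.TensorProduct.one_def]
  · simp only [mul_add, add_mul, Algebra.TensorProduct.tmul_mul_tmul, one_mul, mul_one, K_mul_E,
        TensorProduct.tmul_smul, ← TensorProduct.smul_tmul', smul_add]
  · simp only [mul_add, add_mul, Algebra.TensorProduct.tmul_mul_tmul, one_mul, mul_one, F_mul_K,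
        TensorProduct.tmul_smul, ← TensorProduct.smul_tmul', smul_add, K_mul_Kinv, Kinv_mul_K]
  · simp only [mul_add, add_mul, Algebra.TensorProduct.tmul_mul_tmul, one_mul, mul_one, F_mul_K,
        TensorProduct.tmul_smul, ← TensorProduct.smul_tmul', E_mul_Kinv, E_mul_F,
        TensorProduct.tmul_add, TensorProduct.add_tmul, TensorProduct.tmul_sub,
        TensorProduct.sub_tmul, smul_sub]
    have e1 : (K p * F p) = (q p ^ 2)⁻¹ • (F p * K p) := by
      rw [F_mul_K, smul_smul, inv_mul_cancel₀ (pow_ne_zero _ (q_ne_zero p)), one_smul]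
    rw [e1]
    simp only [TensorProduct.tmul_smul, smul_smul,
      mul_inv_cancel₀ (pow_ne_zero 2 (q_ne_zero p)), one_smul]
    abel

/-- The images of the generators under the counit satisfy the relations. -/
theorem isTriple_counit : IsTriple p (0 : ℂ) 0 1 := by
  have h2 := hp.prop
  refine IsTriple.of_inv (k' := 1) ?_ ?_ ?_ ?_ ?_ ?_ ?_ <;>
    simp [zero_pow (show p ≠ 0 by omega)]

/-- The comultiplication: `Δ E = 1 ⊗ E + E ⊗ K`, `Δ F = K⁻¹ ⊗ F + F ⊗ 1`, `Δ K = K ⊗ K`. -/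
noncomputable def comulHom : Uq p →ₐ[ℂ] Uq p ⊗[ℂ] Uq p := lift (isTriple_comul p)

/-- The counit: `ε E = ε F = 0`, `ε K = 1`. -/
noncomputable def counitHom : Uq p →ₐ[ℂ] ℂ := lift (isTriple_counit p)

theorem comulHom_Kinv : comulHom p (Kinv p) = Kinv p ⊗ₜ[ℂ] Kinv p := by
  rw [comulHom, lift_Kinv, Algebra.TensorProduct.tmul_pow]; rfl

theorem counitHom_Kinv : counitHom p (Kinv p) = 1 := by
  rw [counitHom, lift_Kinv, one_pow]

noncomputable instance : Bialgebra ℂ (Uq p) :=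
  Bialgebra.ofAlgHom (comulHom p) (counitHom p)
    (by
      have hi := comulHom_Kinv p
      unfold comulHom at *
      apply Uq.algHom_ext <;>
        simp [TensorProduct.add_tmul, TensorProduct.tmul_add, Algebra.TensorProduct.one_def, hi,
          add_assoc])
    (by
      have hi := counitHom_Kinv p
      unfold comulHom counitHom at *
      apply Uq.algHom_ext <;> simp [hi])
    (by
      unfold comulHom counitHom
      apply Uq.algHom_ext <;> simp)

theorem comul_E : Coalgebra.comul (R := ℂ) (E p) = 1 ⊗ₜ[ℂ] E p + E p ⊗ₜ[ℂ] K p :=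
  lift_E (isTriple_comul p)
theorem comul_F : Coalgebra.comul (R := ℂ) (F p) = Kinv p ⊗ₜ[ℂ] F p + F p ⊗ₜ[ℂ] 1 :=
  lift_F (isTriple_comul p)
theorem comul_K : Coalgebra.comul (R := ℂ) (K p) = K p ⊗ₜ[ℂ] K p :=
  lift_K (isTriple_comul p)
theorem counit_E : Coalgebra.counit (R := ℂ) (E p) = 0 := lift_E (isTriple_counit p)
theorem counit_F : Coalgebra.counit (R := ℂ) (F p) = 0 := lift_F (isTriple_counit p)
theorem counit_K : Coalgebra.counit (R := ℂ) (K p) = 1 := lift_K (isTriple_counit p)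

theorem exists_mul_pow {B : Type*} [Ring B] [Algebra ℂ B] {c : ℂ} {x y : B}
    (h : y * x = c • (x * y)) (n : ℕ) : ∃ d : ℂ, (y * x) ^ n = d • (x ^ n * y ^ n) := by
  have hk : ∀ k : ℕ, y * x ^ k = c ^ k • (x ^ k * y) := by
    intro k
    induction k with
    | zero => simp
    | succ k ih =>
      rw [pow_succ, ← mul_assoc, ih, smul_mul_assoc, mul_assoc, h, mul_smul_comm, smul_smul,
        ← mul_assoc, ← pow_succ]
  induction n with
  | zero => exact ⟨1, by simp⟩
  | succ n ih =>
    obtain ⟨d, hd⟩ := ih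
    refine ⟨d * (c * c ^ n), ?_⟩
    rw [pow_succ', hd, mul_smul_comm, mul_smul d]
    congr 1
    rw [h, smul_mul_assoc, mul_assoc x, ← mul_assoc y, hk, smul_mul_assoc, mul_smul_comm, smul_smul,
      pow_succ' x, pow_succ' y]
    simp only [mul_assoc]

open MulOpposite in
/-- The images of the generators under the antipode satisfy the relations in the opposite
algebra. -/
theorem isTriple_antipode :
    IsTriple p (op (-(E p * Kinv p))) (op (-(K p * F p))) (op (Kinv p)) := by
  have h2 := hp.prop
  have hT := isTriple p
  have hq : q p ^ 2 ≠ 0 := pow_ne_zero _ (q_ne_zero p)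
  have hKF : K p * F p = (q p ^ 2)⁻¹ • (F p * K p) := by
    rw [F_mul_K, smul_smul, inv_mul_cancel₀ hq, one_smul]
  refine IsTriple.of_inv (k' := op (K p)) ?_ ?_ ?_ ?_ ?_ ?_ ?_
  · obtain ⟨d, hd⟩ := exists_mul_pow (E_mul_Kinv p) p
    rw [← op_pow, neg_pow, hd, hT.e_pow, mul_zero, smul_zero, mul_zero, op_zero]
  · obtain ⟨d, hd⟩ := exists_mul_pow hKF p
    rw [← op_pow, neg_pow, hd, hT.f_pow, zero_mul, smul_zero, mul_zero, op_zero]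
  · rw [← op_pow, Kinv, ← pow_mul, mul_comm, pow_mul, hT.k_pow, one_pow, op_one]
  · rw [← op_mul, K_mul_Kinv, op_one]
  · rw [← op_mul, ← op_mul, ← op_smul, neg_mul, mul_neg, ← mul_assoc, E_mul_Kinv, smul_neg,
      smul_mul_assoc]
  · rw [← op_mul, ← op_mul, ← op_smul, neg_mul, mul_neg, ← mul_assoc, Kinv_mul_K, one_mul, hKF,
      smul_mul_assoc, mul_assoc, K_mul_Kinv, mul_one, smul_neg, smul_smul, mul_inv_cancel₀ hq,
      one_smul]
  · rw [← op_mul, ← op_mul, ← op_sub, ← op_sub, ← op_smul]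
    congr 1
    have e1 : K p * F p * (E p * Kinv p) = F p * E p := by
      rw [E_mul_Kinv, hKF, smul_mul_assoc, mul_smul_comm, smul_smul, inv_mul_cancel₀ hq, one_smul,
        mul_assoc, ← mul_assoc (K p), K_mul_Kinv, one_mul]
    have e2 : E p * Kinv p * (K p * F p) = E p * F p := by
      rw [mul_assoc, ← mul_assoc (Kinv p), Kinv_mul_K, one_mul]
    rw [neg_mul_neg, neg_mul_neg, e1, e2, E_mul_F, smul_sub, smul_sub]
    abel

/-- The antipode as a homomorphism to the opposite algebra: `S E = -E K⁻¹`, `S F = -K F`,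
`S K = K⁻¹`. -/
noncomputable def antipodeHom : Uq p →ₐ[ℂ] (Uq p)ᵐᵒᵖ := lift (isTriple_antipode p)

/-- The antipode as a linear map. -/
noncomputable def antipodeMap : Uq p →ₗ[ℂ] Uq p :=
  (MulOpposite.opLinearEquiv ℂ).symm.toLinearMap ∘ₗ (antipodeHom p).toLinearMap

theorem antipodeMap_apply (x : Uq p) : antipodeMap p x = (antipodeHom p x).unop := rfl

theorem antipodeMap_mul (x y : Uq p) :
    antipodeMap p (x * y) = antipodeMap p y * antipodeMap p x := by
  simp [antipodeMap_apply]

theorem antipodeMap_one : antipodeMap p 1 = 1 := by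
  simp [antipodeMap_apply]

theorem antipodeMap_E : antipodeMap p (E p) = -(E p * Kinv p) := by
  simp [antipodeMap_apply, antipodeHom]

theorem antipodeMap_F : antipodeMap p (F p) = -(K p * F p) := by
  simp [antipodeMap_apply, antipodeHom]

theorem antipodeMap_K : antipodeMap p (K p) = Kinv p := by
  simp [antipodeMap_apply, antipodeHom]

theorem antipodeMap_Kinv : antipodeMap p (Kinv p) = K p := by
  have h := antipodeMap_mul p (K p) (Kinv p)
  rw [K_mul_Kinv, antipodeMap_one, antipodeMap_K] at h
  have h2 := congrArg (· * K p) h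
  simpa [mul_assoc, Kinv_mul_K] using h2.symm

noncomputable instance : HopfAlgebra ℂ (Uq p) where
  antipode := antipodeMap p
  mul_antipode_rTensor_comul := by
    ext x
    have key : ∀ (t : Uq p ⊗[ℂ] Uq p) (b : Uq p) (c : ℂ),
        LinearMap.mul' ℂ _ ((antipodeMap p).rTensor _ (Coalgebra.comul (R := ℂ) b))
          = algebraMap ℂ _ c →
        LinearMap.mul' ℂ _ ((antipodeMap p).rTensor _ (Coalgebra.comul (R := ℂ) b * t))
          = c • LinearMap.mul' ℂ _ ((antipodeMap p).rTensor _ t) := by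
      intro t b c hb
      induction t using TensorProduct.induction_on with
      | zero => simp
      | add u v hu hv => rw [mul_add, map_add, map_add, hu, hv, map_add, map_add, smul_add]
      | tmul u v =>
        have aux : ∀ w : Uq p ⊗[ℂ] Uq p,
            LinearMap.mul' ℂ _ ((antipodeMap p).rTensor _ (w * (u ⊗ₜ[ℂ] v)))
              = antipodeMap p u * LinearMap.mul' ℂ _ ((antipodeMap p).rTensor _ w) * v := by
          intro w
          induction w using TensorProduct.induction_on with
          | zero => simp
          | add x y hx hy => rw [add_mul, map_add, map_add, hx, hy, map_add, map_add, mul_add,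
              add_mul]
          | tmul x y => simp [antipodeMap_mul, mul_assoc]
        rw [aux, hb]
        simp [Algebra.algebraMap_eq_smul_one]
    induction x using Uq.induction with
    | hc c =>
      simp [Algebra.algebraMap_eq_smul_one, Algebra.TensorProduct.one_def, antipodeMap_one]
    | hadd a b ha hb => rw [map_add, map_add, ha, hb]
    | hmul a b ha hb =>
      simp only [LinearMap.comp_apply, Bialgebra.comul_mul, Bialgebra.counit_mul] at *
      rw [key _ _ _ (by simpa using ha), hb]
      simp [Algebra.smul_def]
    | hE => simp [comul_E, counit_E, antipodeMap_E, antipodeMap_one, mul_assoc, Kinv_mul_K]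
    | hF => simp [comul_F, counit_F, antipodeMap_F, antipodeMap_Kinv]
    | hK => simp [comul_K, counit_K, antipodeMap_K, Kinv_mul_K]
  mul_antipode_lTensor_comul := by
    ext x
    have key : ∀ (t : Uq p ⊗[ℂ] Uq p) (b : Uq p) (c : ℂ),
        LinearMap.mul' ℂ _ ((antipodeMap p).lTensor _ (Coalgebra.comul (R := ℂ) b))
          = algebraMap ℂ _ c →
        LinearMap.mul' ℂ _ ((antipodeMap p).lTensor _ (t * Coalgebra.comul (R := ℂ) b))
          = c • LinearMap.mul' ℂ _ ((antipodeMap p).lTensor _ t) := by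
      intro t b c hb
      induction t using TensorProduct.induction_on with
      | zero => simp
      | add u v hu hv => rw [add_mul, map_add, map_add, hu, hv, map_add, map_add, smul_add]
      | tmul u v =>
        have aux : ∀ w : Uq p ⊗[ℂ] Uq p,
            LinearMap.mul' ℂ _ ((antipodeMap p).lTensor _ ((u ⊗ₜ[ℂ] v) * w))
              = u * LinearMap.mul' ℂ _ ((antipodeMap p).lTensor _ w) * antipodeMap p v := by
          intro w
          induction w using TensorProduct.induction_on with
          | zero => simp
          | add x y hx hy => rw [mul_add, map_add, map_add, hx, hy, map_add, map_add, mul_add,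
              add_mul]
          | tmul x y => simp [antipodeMap_mul, mul_assoc]
        rw [aux, hb]
        simp [Algebra.algebraMap_eq_smul_one]
    induction x using Uq.induction with
    | hc c =>
      simp [Algebra.algebraMap_eq_smul_one, Algebra.TensorProduct.one_def, antipodeMap_one]
    | hadd a b ha hb => rw [map_add, map_add, ha, hb]
    | hmul a b ha hb =>
      simp only [LinearMap.comp_apply, Bialgebra.comul_mul, Bialgebra.counit_mul] at *
      rw [key _ _ _ (by simpa using hb), ha]
      simp only [Algebra.linearMap_apply, map_mul, Algebra.smul_def]
      exact Algebra.commutes _ _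
    | hE => simp [comul_E, counit_E, antipodeMap_E, antipodeMap_K]
    | hF => simp [comul_F, counit_F, antipodeMap_F, antipodeMap_one, ← mul_assoc, Kinv_mul_K]
    | hK => simp [comul_K, counit_K, antipodeMap_K, K_mul_Kinv]

end Uq
end relations
end Algebra

section Grothendieck

universe u v

/-- A finite-dimensional representation of an algebra `A` over a field `k`. -/
structure FinRep (k : Type u) (A : Type v) [Field k] [Ring A] [Algebra k A] where
  /-- The underlying vector space. -/
  V : Type u
  [addCommGroup : AddCommGroup V]
  [module : Module k V]
  [finiteDimensional : FiniteDimensional k V]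
  /-- The action. -/
  ρ : A →ₐ[k] Module.End k V

attribute [instance] FinRep.addCommGroup FinRep.module FinRep.finiteDimensional

namespace FinRep

section Algebra
variable {k : Type u} {A : Type v} [Field k] [Ring A] [Algebra k A]

/-- A linear map between representations that commutes with the actions. -/
def IsEquivariant (M N : FinRep k A) (f : M.V →ₗ[k] N.V) : Prop :=
  ∀ (a : A) (v : M.V), f (M.ρ a v) = N.ρ a (f v)

/-- Isomorphic representations. -/
def IsIsomorphic (M N : FinRep k A) : Prop :=
  ∃ e : M.V ≃ₗ[k] N.V, IsEquivariant M N e.toLinearMap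

/-- Irreducible representations: nonzero, and without proper nonzero invariant subspaces. -/
def IsIrreducible (M : FinRep k A) : Prop :=
  Nontrivial M.V ∧
    ∀ W : Submodule k M.V, (∀ (a : A), ∀ w ∈ W, M.ρ a w ∈ W) → W = ⊥ ∨ W = ⊤

/-- There is a short exact sequence `0 → M → N → P → 0` of representations. -/
def IsExtension (M N P : FinRep k A) : Prop :=
  ∃ (f : M.V →ₗ[k] N.V) (g : N.V →ₗ[k] P.V), IsEquivariant M N f ∧ IsEquivariant N P g ∧
    Function.Injective f ∧ Function.Exact f g ∧ Function.Surjective g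

end Algebra

section Action
variable {k : Type u} {A : Type v} [Field k] [Ring A]
variable {V W X : Type*} [AddCommGroup V] [Module k V] [AddCommGroup W] [Module k W]
  [AddCommGroup X] [Module k X]

/-- The action of `A ⊗ A` on the tensor product of two vector spaces with an action of `A`. -/
noncomputable def outer [Algebra k A] (ρ : A →ₐ[k] Module.End k V) (σ : A →ₐ[k] Module.End k W) :
    A ⊗[k] A →ₐ[k] Module.End k (V ⊗[k] W) :=
  (Module.endTensorEndAlgHom (R := k) (S := k) (A := k)).comp (Algebra.TensorProduct.map ρ σ)

theorem outer_tmul [Algebra k A] (ρ : A →ₐ[k] Module.End k V) (σ : A →ₐ[k] Module.End k W)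
    (a b : A) : outer ρ σ (a ⊗ₜ[k] b) = TensorProduct.map (ρ a) (σ b) := rfl

variable [Bialgebra k A]

/-- The action of `A` on the tensor product of two vector spaces with an action of `A`, through
the comultiplication. -/
noncomputable def actTensor (ρ : A →ₐ[k] Module.End k V) (σ : A →ₐ[k] Module.End k W) :
    A →ₐ[k] Module.End k (V ⊗[k] W) :=
  (outer ρ σ).comp (Bialgebra.comulAlgHom k A)

theorem actTensor_apply (ρ : A →ₐ[k] Module.End k V) (σ : A →ₐ[k] Module.End k W) (a : A) :
    actTensor ρ σ a = outer ρ σ (Coalgebra.comul (R := k) a) := rfl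

/-- The action of `A` on the ground field through the counit. -/
noncomputable def actTrivial (k : Type u) (A : Type v) [Field k] [Ring A] [Bialgebra k A] :
    A →ₐ[k] Module.End k k :=
  (Algebra.lmul k k).comp (Bialgebra.counitAlgHom k A)

theorem actTrivial_apply (a : A) (c : k) :
    actTrivial k A a c = Coalgebra.counit (R := k) a * c := rfl

theorem actTensor_lTensor (ρ : A →ₐ[k] Module.End k V) {σ : A →ₐ[k] Module.End k W}
    {τ : A →ₐ[k] Module.End k X} {f : W →ₗ[k] X} (h : ∀ a w, f (σ a w) = τ a (f w)) (a : A)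
    (v : V ⊗[k] W) :
    f.lTensor V (actTensor ρ σ a v) = actTensor ρ τ a (f.lTensor V v) := by
  rw [actTensor_apply, actTensor_apply]
  generalize Coalgebra.comul (R := k) a = t
  induction t using TensorProduct.induction_on with
  | zero => simp
  | add x y hx hy => simp [hx, hy]
  | tmul x y =>
    rw [outer_tmul, outer_tmul]
    induction v using TensorProduct.induction_on with
    | zero => simp
    | add x y hx hy => rw [map_add, map_add, hx, hy, map_add, map_add]
    | tmul v w => simp [h y w]

theorem actTensor_rTensor (ρ : A →ₐ[k] Module.End k V) {σ : A →ₐ[k] Module.End k W}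
    {τ : A →ₐ[k] Module.End k X} {f : W →ₗ[k] X} (h : ∀ a w, f (σ a w) = τ a (f w)) (a : A)
    (v : W ⊗[k] V) :
    f.rTensor V (actTensor σ ρ a v) = actTensor τ ρ a (f.rTensor V v) := by
  rw [actTensor_apply, actTensor_apply]
  generalize Coalgebra.comul (R := k) a = t
  induction t using TensorProduct.induction_on with
  | zero => simp
  | add x y hx hy => simp [hx, hy]
  | tmul x y =>
    rw [outer_tmul, outer_tmul]
    induction v using TensorProduct.induction_on with
    | zero => simp
    | add x y hx hy => rw [map_add, map_add, hx, hy, map_add, map_add]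
    | tmul v w => simp [h x v]

theorem actTensor_lid (ρ : A →ₐ[k] Module.End k V) (a : A) (v : k ⊗[k] V) :
    TensorProduct.lid k V (actTensor (actTrivial k A) ρ a v)
      = ρ a (TensorProduct.lid k V v) := by
  have key : ∀ t : A ⊗[k] A, TensorProduct.lid k V (outer (actTrivial k A) ρ t v)
        = ρ (TensorProduct.lid k A ((Coalgebra.counit (R := k)).rTensor A t))
            (TensorProduct.lid k V v) := by
    intro t
    induction t using TensorProduct.induction_on with
    | zero => simp
    | add x y hx hy => simp [hx, hy]
    | tmul x y =>
      rw [outer_tmul]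
      induction v using TensorProduct.induction_on with
      | zero => simp
      | add x y hx hy => rw [map_add, map_add, hx, hy, map_add, map_add]
      | tmul c w => simp [actTrivial_apply, smul_smul, mul_comm]
  rw [actTensor_apply, key, Coalgebra.rTensor_counit_comul]
  simp

theorem actTensor_rid (ρ : A →ₐ[k] Module.End k V) (a : A) (v : V ⊗[k] k) :
    TensorProduct.rid k V (actTensor ρ (actTrivial k A) a v)
      = ρ a (TensorProduct.rid k V v) := by
  have key : ∀ t : A ⊗[k] A, TensorProduct.rid k V (outer ρ (actTrivial k A) t v)
        = ρ (TensorProduct.rid k A ((Coalgebra.counit (R := k)).lTensor A t))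
            (TensorProduct.rid k V v) := by
    intro t
    induction t using TensorProduct.induction_on with
    | zero => simp
    | add x y hx hy => simp [hx, hy]
    | tmul x y =>
      rw [outer_tmul]
      induction v using TensorProduct.induction_on with
      | zero => simp
      | add x y hx hy => rw [map_add, map_add, hx, hy, map_add, map_add]
      | tmul w c => simp [actTrivial_apply, smul_smul, mul_comm]
  rw [actTensor_apply, key, Coalgebra.lTensor_counit_comul]
  simp

theorem actTensor_assoc (ρ : A →ₐ[k] Module.End k V) (σ : A →ₐ[k] Module.End k W)
    (τ : A →ₐ[k] Module.End k X) (a : A) (v : (V ⊗[k] W) ⊗[k] X) :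
    TensorProduct.assoc k V W X (actTensor (actTensor ρ σ) τ a v)
      = actTensor ρ (actTensor σ τ) a (TensorProduct.assoc k V W X v) := by
  -- the actions of threefold tensors
  let Φ : (A ⊗[k] A) ⊗[k] A →ₗ[k] Module.End k ((V ⊗[k] W) ⊗[k] X) :=
    TensorProduct.homTensorHomMap (RingHom.id k) _ _ _ _ ∘ₗ
      TensorProduct.map (outer ρ σ).toLinearMap τ.toLinearMap
  let Ψ : A ⊗[k] (A ⊗[k] A) →ₗ[k] Module.End k (V ⊗[k] (W ⊗[k] X)) :=
    TensorProduct.homTensorHomMap (RingHom.id k) _ _ _ _ ∘ₗ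
      TensorProduct.map ρ.toLinearMap (outer σ τ).toLinearMap
  have h1 : ∀ t : A ⊗[k] A, outer (actTensor ρ σ) τ t
      = Φ ((Coalgebra.comul (R := k)).rTensor A t) := by
    intro t
    induction t using TensorProduct.induction_on with
    | zero => simp
    | add x y hx hy => rw [map_add, map_add, map_add, hx, hy]
    | tmul x y => rfl
  have h2 : ∀ t : A ⊗[k] A, outer ρ (actTensor σ τ) t
      = Ψ ((Coalgebra.comul (R := k)).lTensor A t) := by
    intro t
    induction t using TensorProduct.induction_on with
    | zero => simp
    | add x y hx hy => rw [map_add, map_add, map_add, hx, hy]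
    | tmul x y => rfl
  have h3 : ∀ (t : (A ⊗[k] A) ⊗[k] A) (v : (V ⊗[k] W) ⊗[k] X),
      TensorProduct.assoc k V W X (Φ t v)
        = Ψ (TensorProduct.assoc k A A A t) (TensorProduct.assoc k V W X v) := by
    intro t v
    induction t using TensorProduct.induction_on with
    | zero => simp
    | add x y hx hy => simp only [map_add, LinearMap.add_apply, hx, hy]
    | tmul xy z =>
      induction xy using TensorProduct.induction_on with
      | zero => simp
      | add x y hx hy => simp only [TensorProduct.add_tmul, map_add, LinearMap.add_apply, hx, hy]
      | tmul x y =>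
        induction v using TensorProduct.induction_on with
        | zero => simp
        | add x y hx hy => simp only [map_add, hx, hy]
        | tmul vw u =>
          induction vw using TensorProduct.induction_on with
          | zero => simp
          | add x y hx hy => simp only [TensorProduct.add_tmul, map_add, hx, hy]
          | tmul v w => rfl
  rw [actTensor_apply, actTensor_apply, h1, h2, h3, Coalgebra.coassoc_apply]

end Action

section Bialgebra
variable {k : Type u} {A : Type v} [Field k] [Ring A] [Bialgebra k A]

/-- The trivial representation, on which `A` acts through the counit. -/
noncomputable def trivial (k : Type u) (A : Type v) [Field k] [Ring A] [Bialgebra k A] :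
    FinRep k A where
  V := k
  ρ := actTrivial k A

/-- The tensor product of two representations, on which `A` acts through the
comultiplication. -/
noncomputable def tensor (M N : FinRep k A) : FinRep k A where
  V := M.V ⊗[k] N.V
  ρ := actTensor M.ρ N.ρ

theorem IsExtension.lTensor (L : FinRep k A) {M N P : FinRep k A} (h : IsExtension M N P) :
    IsExtension (tensor L M) (tensor L N) (tensor L P) := by
  obtain ⟨f, g, hf, hg, h1, h2, h3⟩ := h
  exact ⟨f.lTensor L.V, g.lTensor L.V, actTensor_lTensor L.ρ hf, actTensor_lTensor L.ρ hg,
    Module.Flat.lTensor_preserves_injective_linearMap f h1, _root_.lTensor_exact L.V h2 h3,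
    LinearMap.lTensor_surjective L.V h3⟩

theorem IsExtension.rTensor (L : FinRep k A) {M N P : FinRep k A} (h : IsExtension M N P) :
    IsExtension (tensor M L) (tensor N L) (tensor P L) := by
  obtain ⟨f, g, hf, hg, h1, h2, h3⟩ := h
  exact ⟨f.rTensor L.V, g.rTensor L.V, actTensor_rTensor L.ρ hf, actTensor_rTensor L.ρ hg,
    Module.Flat.rTensor_preserves_injective_linearMap f h1, _root_.rTensor_exact L.V h2 h3,
    LinearMap.rTensor_surjective L.V h3⟩

theorem tensor_trivial_left (M : FinRep k A) : IsIsomorphic (tensor (trivial k A) M) M :=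
  ⟨TensorProduct.lid k M.V, actTensor_lid M.ρ⟩

theorem tensor_trivial_right (M : FinRep k A) : IsIsomorphic (tensor M (trivial k A)) M :=
  ⟨TensorProduct.rid k M.V, actTensor_rid M.ρ⟩

theorem tensor_assoc (L M N : FinRep k A) :
    IsIsomorphic (tensor (tensor L M) N) (tensor L (tensor M N)) :=
  ⟨TensorProduct.assoc k L.V M.V N.V, actTensor_assoc L.ρ M.ρ N.ρ⟩

end Bialgebra

end FinRep

section Group
variable (k : Type u) (A : Type v) [Field k] [Ring A] [Algebra k A]

/-- The relations `[N] = [M] + [P]` for short exact sequences `0 → M → N → P → 0`. -/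
def extensionRelations : AddSubgroup (FreeAbelianGroup (FinRep k A)) :=
  AddSubgroup.closure {x | ∃ M N P : FinRep k A, FinRep.IsExtension M N P ∧
    x = FreeAbelianGroup.of N - (FreeAbelianGroup.of M + FreeAbelianGroup.of P)}

/-- The Grothendieck group of finite-dimensional representations: the free abelian group on
representations modulo the relations from short exact sequences. -/
def GrothendieckRing : Type (max (u + 1) v) :=
  FreeAbelianGroup (FinRep k A) ⧸ extensionRelations k A

noncomputable instance : AddCommGroup (GrothendieckRing k A) :=
  inferInstanceAs (AddCommGroup (FreeAbelianGroup (FinRep k A) ⧸ extensionRelations k A))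

end Group

namespace FinRep

variable {k : Type u} {A : Type v} [Field k] [Ring A] [Algebra k A]

/-- The class of a representation in the Grothendieck group. -/
noncomputable def cls (M : FinRep k A) : GrothendieckRing k A :=
  QuotientAddGroup.mk' (extensionRelations k A) (FreeAbelianGroup.of M)

theorem IsExtension.cls_eq {M N P : FinRep k A} (h : IsExtension M N P) :
    N.cls = M.cls + P.cls := by
  rw [← sub_eq_zero]
  refine (QuotientAddGroup.eq_zero_iff (N := extensionRelations k A)
    (FreeAbelianGroup.of N - (FreeAbelianGroup.of M + FreeAbelianGroup.of P))).mpr ?_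
  exact AddSubgroup.subset_closure ⟨M, N, P, h, rfl⟩

theorem IsIsomorphic.cls_eq {M N : FinRep k A} (h : IsIsomorphic M N) : M.cls = N.cls := by
  obtain ⟨e, he⟩ := h
  let Z : FinRep k A :=
    { V := PUnit
      ρ := { toFun := fun _ => 0, map_one' := rfl, map_mul' := fun _ _ => rfl, map_zero' := rfl,
             map_add' := fun _ _ => rfl, commutes' := fun _ => rfl } }
  have hZ : IsExtension Z Z Z := ⟨0, 0, fun _ _ => rfl, fun _ _ => rfl,
    fun _ _ _ => rfl, fun x => ⟨fun _ => ⟨x, rfl⟩, fun _ => rfl⟩, fun x => ⟨x, rfl⟩⟩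
  have hZ0 : Z.cls = 0 := by simpa using hZ.cls_eq
  have h1 : IsExtension M N Z := ⟨e.toLinearMap, 0, he, fun _ _ => rfl, e.injective,
    fun x => ⟨fun _ => e.surjective x, fun _ => rfl⟩, fun x => ⟨0, rfl⟩⟩
  rw [h1.cls_eq, hZ0, add_zero]

end FinRep

namespace GrothendieckRing

section Group
variable {k : Type u} {A : Type v} [Field k] [Ring A] [Algebra k A]
variable {G : Type*} [AddCommGroup G]

/-- A function on representations that is additive on short exact sequences defines a
homomorphism on the Grothendieck group. -/
noncomputable def lift (φ : FinRep k A → G)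
    (h : ∀ M N P, FinRep.IsExtension M N P → φ N = φ M + φ P) : GrothendieckRing k A →+ G :=
  QuotientAddGroup.lift (extensionRelations k A) (FreeAbelianGroup.lift φ) (by
    unfold extensionRelations
    rw [AddSubgroup.closure_le]
    rintro x ⟨M, N, P, hx, rfl⟩
    simp [h M N P hx])

@[simp] theorem lift_cls (φ : FinRep k A → G)
    (h : ∀ M N P, FinRep.IsExtension M N P → φ N = φ M + φ P) (M : FinRep k A) :
    lift φ h M.cls = φ M := by
  change FreeAbelianGroup.lift φ (FreeAbelianGroup.of M) = φ M
  simp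

theorem induction {C : GrothendieckRing k A → Prop} (hcls : ∀ M : FinRep k A, C M.cls)
    (hneg : ∀ x, C x → C (-x)) (hadd : ∀ x y, C x → C y → C (x + y)) (h0 : C 0)
    (x : GrothendieckRing k A) : C x := by
  obtain ⟨y, rfl⟩ := QuotientAddGroup.mk'_surjective (extensionRelations k A) x
  induction y using FreeAbelianGroup.induction_on with
  | zero => exact h0
  | of M => exact hcls M
  | neg M h => exact hneg _ h
  | add a b ha hb => exact hadd _ _ ha hb

theorem hom_ext {φ ψ : GrothendieckRing k A →+ G} (h : ∀ M : FinRep k A, φ M.cls = ψ M.cls) :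
    φ = ψ := by
  ext x
  induction x using induction with
  | hcls M => exact h M
  | hneg x hx => rw [map_neg, map_neg, hx]
  | hadd x y hx hy => rw [map_add, map_add, hx, hy]
  | h0 => rw [map_zero, map_zero]

end Group

variable {k : Type u} {A : Type v} [Field k] [Ring A] [Bialgebra k A]

/-- The biadditive product on the Grothendieck group with `[M] [N] = [M ⊗ N]`. -/
noncomputable def mulHom :
    GrothendieckRing k A →+ GrothendieckRing k A →+ GrothendieckRing k A :=
  lift (fun M => lift (fun N => (M.tensor N).cls) fun _ _ _ h => (h.lTensor M).cls_eq)
    fun _ _ _ h => hom_ext fun L => by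
      simpa using (h.rTensor L).cls_eq

noncomputable instance : Mul (GrothendieckRing k A) := ⟨fun x y => mulHom x y⟩

noncomputable instance : One (GrothendieckRing k A) := ⟨(FinRep.trivial k A).cls⟩

theorem mul_def (x y : GrothendieckRing k A) : x * y = mulHom x y := rfl

theorem one_def : (1 : GrothendieckRing k A) = (FinRep.trivial k A).cls := rfl

theorem cls_mul_cls (M N : FinRep k A) : M.cls * N.cls = (M.tensor N).cls := by
  rw [mul_def, mulHom, lift_cls, lift_cls]

/-- The Grothendieck ring of a bialgebra. -/
noncomputable instance : Ring (GrothendieckRing k A) :=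
  { (inferInstance : AddCommGroup (GrothendieckRing k A)),
    (inferInstance : Mul (GrothendieckRing k A)),
    (inferInstance : One (GrothendieckRing k A)) with
    left_distrib := fun x y z => by simp only [mul_def, map_add]
    right_distrib := fun x y z => by simp only [mul_def, map_add, AddMonoidHom.add_apply]
    zero_mul := fun x => by simp only [mul_def, map_zero, AddMonoidHom.zero_apply]
    mul_zero := fun x => by simp only [mul_def, map_zero]
    mul_assoc := fun x y z => by
      induction x using induction with
      | hneg x hx => simp only [mul_def, map_neg, AddMonoidHom.neg_apply] at *; rw [hx]
      | hadd x y hx hy => simp only [mul_def, map_add, AddMonoidHom.add_apply] at *; rw [hx, hy]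
      | h0 => simp only [mul_def, map_zero, AddMonoidHom.zero_apply]
      | hcls L =>
      induction y using induction with
      | hneg x hx => simp only [mul_def, map_neg, AddMonoidHom.neg_apply] at *; rw [hx]
      | hadd x y hx hy => simp only [mul_def, map_add, AddMonoidHom.add_apply] at *; rw [hx, hy]
      | h0 => simp only [mul_def, map_zero, AddMonoidHom.zero_apply]
      | hcls M =>
      induction z using induction with
      | hneg x hx => simp only [mul_def, map_neg] at *; rw [hx]
      | hadd x y hx hy => simp only [mul_def, map_add] at *; rw [hx, hy]
      | h0 => simp only [mul_def, map_zero]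
      | hcls N =>
        rw [cls_mul_cls, cls_mul_cls, cls_mul_cls, cls_mul_cls]
        exact (FinRep.tensor_assoc L M N).cls_eq
    one_mul := fun x => by
      induction x using induction with
      | hneg x hx => simp only [mul_def, map_neg] at *; rw [hx]
      | hadd x y hx hy => simp only [mul_def, map_add] at *; rw [hx, hy]
      | h0 => simp only [mul_def, map_zero]
      | hcls M => rw [one_def, cls_mul_cls]; exact (FinRep.tensor_trivial_left M).cls_eq
    mul_one := fun x => by
      induction x using induction with
      | hneg x hx => simp only [mul_def, map_neg, AddMonoidHom.neg_apply] at *; rw [hx]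
      | hadd x y hx hy => simp only [mul_def, map_add, AddMonoidHom.add_apply] at *; rw [hx, hy]
      | h0 => simp only [mul_def, map_zero, AddMonoidHom.zero_apply]
      | hcls M => rw [one_def, cls_mul_cls]; exact (FinRep.tensor_trivial_right M).cls_eq }

end GrothendieckRing
end Grothendieck

section Irreducibles

variable (p : ℕ)

/-- The labels `(α, s)` with `α = ±1` and `1 ≤ s ≤ p`. -/
abbrev Label : Type := ℤˣ × Set.Icc 1 p

/-- The `n`-th basis vector of `ℂ^s`, and `0` for `n ≥ s`. -/
noncomputable def vec (s n : ℕ) : Fin s → ℂ :=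
  if h : n < s then Pi.single ⟨n, h⟩ 1 else 0

/-- The linear operator on `ℂ^s` with given values on the basis vectors. -/
noncomputable def opOf (s : ℕ) (f : ℕ → Fin s → ℂ) : Module.End ℂ (Fin s → ℂ) :=
  (Pi.basisFun ℂ (Fin s)).constr ℂ fun n => f n

/-- The operator `v_n ↦ α 𝔮^(s - 1 - 2n) v_n`. -/
noncomputable def opK (α : ℤˣ) (s : ℕ) : Module.End ℂ (Fin s → ℂ) :=
  opOf s fun n => (((α : ℤ) : ℂ) * q p ^ ((s : ℤ) - 1 - 2 * n)) • vec s n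

/-- The operator `v_n ↦ α [n] [s - n] v_(n-1)` (which sends `v_0` to `0` as `[0] = 0`). -/
noncomputable def opE (α : ℤˣ) (s : ℕ) : Module.End ℂ (Fin s → ℂ) :=
  opOf s fun n => (((α : ℤ) : ℂ) * qInt p n * qInt p ((s : ℤ) - n)) • vec s (n - 1)

/-- The operator `v_n ↦ v_(n+1)`, where `v_s = 0`. -/
noncomputable def opF (s : ℕ) : Module.End ℂ (Fin s → ℂ) :=
  opOf s fun n => vec s (n + 1)

theorem opOf_vec {s n : ℕ} (f : ℕ → Fin s → ℂ) (h : n < s) : opOf s f (vec s n) = f n := by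
  have := (Pi.basisFun ℂ (Fin s)).constr_basis ℂ (fun n : Fin s => f n) ⟨n, h⟩
  simpa only [opOf, vec, h, dif_pos, Pi.basisFun_apply] using this

theorem vec_of_le {s n : ℕ} (h : s ≤ n) : vec s n = 0 := dif_neg (not_lt.mpr h)

theorem end_ext {s : ℕ} {f g : Module.End ℂ (Fin s → ℂ)}
    (h : ∀ n < s, f (vec s n) = g (vec s n)) : f = g := by
  apply (Pi.basisFun ℂ (Fin s)).ext
  intro n
  simpa [vec, n.2] using h n n.2

theorem opF_vec (s n : ℕ) : opF s (vec s n) = vec s (n + 1) := by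
  rcases lt_or_ge n s with h | h
  · rw [opF, opOf_vec _ h]
  · rw [vec_of_le h, vec_of_le (by omega), map_zero]

theorem opF_pow_vec (s j n : ℕ) : (opF s ^ j) (vec s n) = vec s (n + j) := by
  induction j generalizing n with
  | zero => rfl
  | succ j ih => rw [pow_succ, Module.End.mul_apply, opF_vec, ih]; congr 1; omega

variable {p}

theorem opE_vec {s n : ℕ} (α : ℤˣ) (h : n < s) : opE p α s (vec s n)
    = (((α : ℤ) : ℂ) * qInt p n * qInt p ((s : ℤ) - n)) • vec s (n - 1) := by
  rw [opE, opOf_vec _ h]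

theorem opK_vec {s n : ℕ} (α : ℤˣ) (h : n < s) : opK p α s (vec s n)
    = (((α : ℤ) : ℂ) * q p ^ ((s : ℤ) - 1 - 2 * n)) • vec s n := by
  rw [opK, opOf_vec _ h]

theorem qInt_zero : qInt p 0 = 0 := by simp [qInt]

theorem opE_pow_vec (α : ℤˣ) {s : ℕ} (n : ℕ) (h : n < s) : (opE p α s ^ (n + 1)) (vec s n) = 0 := by
  induction n with
  | zero => simp [opE_vec α h, qInt_zero]
  | succ n ih =>
    rw [pow_succ, Module.End.mul_apply, opE_vec α h, map_smul, Nat.add_sub_cancel,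
      ih (by omega), smul_zero]

theorem opK_pow_vec (α : ℤˣ) {s n : ℕ} (h : n < s) (j : ℕ) : (opK p α s ^ j) (vec s n)
    = (((α : ℤ) : ℂ) * q p ^ ((s : ℤ) - 1 - 2 * n)) ^ j • vec s n := by
  induction j with
  | zero => simp
  | succ j ih => rw [pow_succ, Module.End.mul_apply, opK_vec α h, map_smul, ih, smul_smul, pow_succ']

theorem sign_sq (α : ℤˣ) : ((α : ℤ) : ℂ) * ((α : ℤ) : ℂ) = 1 := by
  rcases Int.units_eq_one_or α with rfl | rfl <;> simp

theorem qInt_rel [p.AtLeastTwo] (a b : ℤ) :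
    qInt p (a + 1) * qInt p (b - 1) - qInt p a * qInt p b
      = (q p - (q p)⁻¹)⁻¹ * (q p ^ (b - 1 - a) - q p ^ (-(b - 1 - a))) := by
  have h0 := q_ne_zero p
  have h1 := q_sub_inv_ne_zero p
  have e : (q p ^ (a + 1) - q p ^ (-(a + 1))) * (q p ^ (b - 1) - q p ^ (-(b - 1)))
      - (q p ^ a - q p ^ (-a)) * (q p ^ b - q p ^ (-b))
      = (q p - (q p)⁻¹) * (q p ^ (b - 1 - a) - q p ^ (-(b - 1 - a))) := by
    simp only [neg_sub, neg_add, zpow_sub₀ h0, zpow_add₀ h0, zpow_neg, zpow_one]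
    have ha : q p ^ a ≠ 0 := zpow_ne_zero _ h0
    have hb : q p ^ b ≠ 0 := zpow_ne_zero _ h0
    field_simp
    ring
  unfold qInt
  rw [div_mul_div_comm, div_mul_div_comm, ← sub_div, e]
  field_simp

theorem isTriple_op [p.AtLeastTwo] (α : ℤˣ) {s : ℕ} (hs : s ≤ p) :
    IsTriple p (opE p α s) (opF s) (opK p α s) := by
  have h0 := q_ne_zero p
  have hα := sign_sq α
  set κ : ℕ → ℂ := fun n => ((α : ℤ) : ℂ) * q p ^ ((s : ℤ) - 1 - 2 * n) with hκ
  let k' : Module.End ℂ (Fin s → ℂ) :=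
    opOf s fun n => (((α : ℤ) : ℂ) * q p ^ (-((s : ℤ) - 1 - 2 * n))) • vec s n
  have hstep : ∀ n : ℕ, κ n = q p ^ 2 * κ (n + 1) := by
    intro n
    have : (s : ℤ) - 1 - 2 * n = 2 + ((s : ℤ) - 1 - 2 * (n + 1 : ℕ)) := by push_cast; ring
    simp only [hκ]
    rw [this, zpow_add₀ h0, zpow_ofNat]
    ring
  refine IsTriple.of_inv (k' := k') ?_ ?_ ?_ ?_ ?_ ?_ ?_ <;> apply end_ext <;> intro n hn
  · have : p = (p - (n + 1)) + (n + 1) := by omega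
    rw [this, pow_add, Module.End.mul_apply, opE_pow_vec α n hn, map_zero]
    rfl
  · rw [opF_pow_vec, vec_of_le (by omega)]
    rfl
  · have h1 : (q p ^ ((s : ℤ) - 1 - 2 * n)) ^ (2 * p) = 1 := by
      rw [← zpow_natCast, ← zpow_mul, mul_comm, zpow_mul, zpow_natCast, q_pow_two_p, one_zpow]
    rw [opK_pow_vec α hn, mul_pow, h1, mul_one, pow_mul, pow_two, hα, one_pow, one_smul]
    rfl
  · rw [Module.End.mul_apply, opOf_vec _ hn, map_smul, opK_vec α hn, smul_smul]
    rw [mul_mul_mul_comm, hα, ← zpow_add₀ h0, neg_add_cancel, zpow_zero, one_mul, one_smul]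
    rfl
  · rw [Module.End.mul_apply, LinearMap.smul_apply, Module.End.mul_apply, opE_vec α hn, map_smul,
      opK_vec α hn, map_smul, opE_vec α hn]
    cases n with
    | zero => simp [qInt_zero]
    | succ n =>
      rw [Nat.add_sub_cancel, opK_vec α (by omega : n < s)]
      change _ • κ n • _ = _ • κ (n + 1) • _
      rw [hstep n]
      simp only [smul_smul]
      congr 1
      ring
  · rw [Module.End.mul_apply, LinearMap.smul_apply, Module.End.mul_apply, opF_vec, opK_vec α hn,
      map_smul, opF_vec]
    rcases Nat.lt_or_ge (n + 1) s with h | h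
    · rw [opK_vec α h]
      change κ n • _ = _ • κ (n + 1) • _
      rw [hstep n, smul_smul]
    · rw [vec_of_le h]; simp
  · have hL : (opE p α s * opF s - opF s * opE p α s) (vec s n)
        = (((α : ℤ) : ℂ) * (qInt p ((n : ℤ) + 1) * qInt p (((s : ℤ) - n) - 1)
            - qInt p n * qInt p ((s : ℤ) - n))) • vec s n := by
      have hF : opF s (opE p α s (vec s n))
          = (((α : ℤ) : ℂ) * qInt p n * qInt p ((s : ℤ) - n)) • vec s n := by
        rw [opE_vec α hn, map_smul, opF_vec]
        cases n with
        | zero => simp [qInt_zero]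
        | succ n => simp
      have hE : opE p α s (opF s (vec s n))
          = (((α : ℤ) : ℂ) * qInt p ((n : ℤ) + 1) * qInt p (((s : ℤ) - n) - 1)) • vec s n := by
        rw [opF_vec]
        rcases Nat.lt_or_ge (n + 1) s with h | h
        · rw [opE_vec α h, Nat.add_sub_cancel]
          congr 3
          · push_cast; ring
        · have : (s : ℤ) - n - 1 = 0 := by omega
          rw [vec_of_le h, map_zero, this, qInt_zero, mul_zero, zero_smul]
      rw [LinearMap.sub_apply, Module.End.mul_apply, Module.End.mul_apply, hE, hF, ← sub_smul]
      congr 1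
      ring
    rw [hL, qInt_rel, LinearMap.smul_apply, LinearMap.sub_apply, opK_vec α hn, opOf_vec _ hn,
      ← sub_smul, smul_smul]
    congr 1
    rw [show (s : ℤ) - n - 1 - n = (s : ℤ) - 1 - 2 * n by ring]
    ring

/-- The irreducible representation `X^α(s)` of dimension `s`:
`K v_n = α 𝔮^(s - 1 - 2n) v_n`, `E v_n = α [n] [s - n] v_(n-1)`, `F v_n = v_(n+1)` for
`0 ≤ n ≤ s - 1`, where `v_(-1) = v_s = 0`. -/
noncomputable def irr [p.AtLeastTwo] (i : Label p) : FinRep ℂ (Uq p) where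
  V := Fin i.2.1 → ℂ
  ρ := Uq.lift (isTriple_op i.1 i.2.2.2)

end Irreducibles

section Fusion

variable {p : ℕ} {G : Type*} [AddCommGroup G]

/-- For a family `χ^α(s)`, `1 ≤ s ≤ p`, of elements of an abelian group: the elements
`χ̃^α(s) = χ^α(s)` for `1 ≤ s ≤ p` and `χ̃^α(s) = χ^α(2p - s) + 2 χ^(-α)(s - p)` for
`p + 1 ≤ s ≤ 2p - 1` (and `0` for all other `s`, which do not occur). -/
def tilde (χ : Label p → G) (α : ℤˣ) (s : ℕ) : G :=
  if h : 1 ≤ s ∧ s ≤ p then χ (α, ⟨s, h⟩)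
  else if h : p + 1 ≤ s ∧ s ≤ 2 * p - 1 then
    χ (α, ⟨2 * p - s, by constructor <;> omega⟩)
      + 2 • χ (-α, ⟨s - p, by constructor <;> omega⟩)
  else 0

/-- The sum of `χ̃^(αα')(s'')` over `s'' = |s - s'| + 1, |s - s'| + 3, …, s + s' - 1`. -/
def fusionSum (χ : Label p → G) (i j : Label p) : G :=
  ∑ t ∈ (Finset.Icc ((((i.2 : ℕ) : ℤ) - ((j.2 : ℕ) : ℤ)).natAbs + 1) ((i.2 : ℕ) + (j.2 : ℕ) - 1)).filter
      (fun t => t ≡ (((i.2 : ℕ) : ℤ) - ((j.2 : ℕ) : ℤ)).natAbs + 1 [MOD 2]),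
    tilde χ (i.1 * j.1) t

/-- The underlying group of the `(1,p)` fusion algebra: the free abelian group on the symbols
`χ^α(s)`. -/
def FusionAlgebra (p : ℕ) : Type := Label p →₀ ℤ

namespace FusionAlgebra

noncomputable instance : AddCommGroup (FusionAlgebra p) :=
  inferInstanceAs (AddCommGroup (Label p →₀ ℤ))

/-- The basis element `χ^α(s)`. -/
noncomputable def χ (i : Label p) : FusionAlgebra p := Finsupp.single i (1 : ℤ)

/-- The biadditive product with `χ^α(s) χ^α'(s') = ∑ χ̃^(αα')(s'')`. -/
noncomputable def mulHom : (Label p →₀ ℤ) →ₗ[ℤ] (Label p →₀ ℤ) →ₗ[ℤ] FusionAlgebra p :=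
  Finsupp.linearCombination ℤ fun i => Finsupp.linearCombination ℤ fun j => fusionSum χ i j

noncomputable instance : Mul (FusionAlgebra p) := ⟨fun x y => mulHom x y⟩

/-- The `(1,p)` fusion algebra (associativity is not part of the definition). -/
noncomputable instance : NonUnitalNonAssocRing (FusionAlgebra p) :=
  { (inferInstance : AddCommGroup (FusionAlgebra p)),
    (inferInstance : Mul (FusionAlgebra p)) with
    left_distrib := fun x y z => map_add (mulHom x) y z
    right_distrib := fun x y z => LinearMap.map_add₂ mulHom x y z
    zero_mul := fun x => LinearMap.map_zero₂ mulHom x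
    mul_zero := fun x => map_zero (mulHom x) }

theorem χ_mul_χ (i j : Label p) : χ i * χ j = fusionSum χ i j := by
  change mulHom (Finsupp.single i 1) (Finsupp.single j 1) = _
  simp [mulHom]

end FusionAlgebra

end Fusion

end RestrictedQuantum

open RestrictedQuantum

/-! Singular vectors, that is, `K`-eigenvectors killed by `E`, govern the representations. As `E` is
nilpotent and `K^(2p) = 1`, every nonzero representation contains one of weight `α 𝔮^(s-1)` with `1
≤ s ≤ p` (`exists_isSingular`). The formula for `E F^(j+1) v` (`E_F_pow_apply`) makes `F^s v`
singular as well, and in an irreducible representation nilpotency of `F` forces `F^s v = 0`, so the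
representation is `X^α(s)` (`IsIrreducible.exists_isIsomorphic`). Induction on the dimension then
shows that the classes of the `X^α(s)` span the Grothendieck group. They are independent because
traces are additive on extensions and the traces of the elements `separator` form a triangular
system (`linearIndependent_irr_cls`).

For the product it is enough to understand two factors. Tensoring with `X^-(1)` flips the sign. In
`X^+(2) ⊗ X^α(s)`, with `a` and `v` the highest weight vectors, `a ⊗ v` is singular and `F a ⊗ v` is
singular modulo what `a ⊗ v` generates. For `s < p` this gives `X^α(s+1) + X^α(s-1)`; for `s = p`
both pieces have dimension `p`, and each splits into `X^α(p-1)` and `X^(-α)(1)`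
(`IsHighestWeight.cls_eq_add`).

These rules say that the elements `χ̃^α(s)`, for `s ≤ 2p - 1`, obey the Chebyshev recursion in
`X^+(2)`. Hence `χ̃^α(s)` is the Chebyshev polynomial `S_(s-1)` of `X^+(2)` times `X^α(1)`
(`tildeCls_eq`), and the fusion rule becomes the product formula for these polynomials
(`chebyshev_S_mul_S`). The fusion algebra has the same structure constants on its basis, so the
linear isomorphism matching the bases is multiplicative. -/

namespace RestrictedQuantum

universe u v

/-! ### Subrepresentations, quotients, traces and Schur's lemma. -/

namespace FinRep

variable {k : Type u} {A : Type v} [Field k] [Ring A] [Algebra k A]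

/-- A subspace that is stable under the action. -/
def IsInvariant (M : FinRep k A) (W : Submodule k M.V) : Prop :=
  ∀ (a : A), ∀ w ∈ W, M.ρ a w ∈ W

/-- The subrepresentation on an invariant subspace. -/
def sub (M : FinRep k A) (W : Submodule k M.V) (h : M.IsInvariant W) : FinRep k A where
  V := W
  ρ := AlgHom.ofLinearMap
    { toFun := fun a => (M.ρ a).restrict (h a)
      map_add' := fun a b => by ext x; simp
      map_smul' := fun c a => by ext x; simp }
    (by ext x; simp) (fun a b => by ext x; simp)

/-- The inclusion of a subrepresentation. -/
def subι (M : FinRep k A) (W : Submodule k M.V) (h : M.IsInvariant W) :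
    (M.sub W h).V →ₗ[k] M.V := W.subtype

theorem subι_apply (M : FinRep k A) (W : Submodule k M.V) (h : M.IsInvariant W) (a : A)
    (x : (M.sub W h).V) : M.subι W h ((M.sub W h).ρ a x) = M.ρ a (M.subι W h x) := rfl

theorem subι_injective (M : FinRep k A) (W : Submodule k M.V) (h : M.IsInvariant W) :
    Function.Injective (M.subι W h) := W.injective_subtype

theorem subι_mem (M : FinRep k A) (W : Submodule k M.V) (h : M.IsInvariant W)
    (x : (M.sub W h).V) : M.subι W h x ∈ W := Subtype.property x

theorem range_subι (M : FinRep k A) (W : Submodule k M.V) (h : M.IsInvariant W) :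
    LinearMap.range (M.subι W h) = W := W.range_subtype

/-- The quotient representation by an invariant subspace. -/
def quot (M : FinRep k A) (W : Submodule k M.V) (h : M.IsInvariant W) : FinRep k A where
  V := M.V ⧸ W
  ρ := AlgHom.ofLinearMap
    { toFun := fun a => W.mapQ W (M.ρ a) (h a)
      map_add' := fun a b => by ext x; simp
      map_smul' := fun c a => by ext x; simp }
    (by ext x; simp) (fun a b => by ext x; simp)

/-- The projection to a quotient representation. -/
def quotπ (M : FinRep k A) (W : Submodule k M.V) (h : M.IsInvariant W) :
    M.V →ₗ[k] (M.quot W h).V := W.mkQ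

theorem range_quotπ (M : FinRep k A) (W : Submodule k M.V) (h : M.IsInvariant W) :
    LinearMap.range (M.quotπ W h) = ⊤ := W.range_mkQ

theorem ker_quotπ (M : FinRep k A) (W : Submodule k M.V) (h : M.IsInvariant W) :
    LinearMap.ker (M.quotπ W h) = W := W.ker_mkQ

theorem cls_eq_sub_add_quot (M : FinRep k A) (W : Submodule k M.V) (h : M.IsInvariant W) :
    M.cls = (M.sub W h).cls + (M.quot W h).cls :=
  IsExtension.cls_eq ⟨W.subtype, W.mkQ, fun _ _ => rfl, fun _ _ => rfl, W.injective_subtype,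
    LinearMap.exact_subtype_mkQ W, W.mkQ_surjective⟩

theorem finrank_sub_add_quot (M : FinRep k A) (W : Submodule k M.V) (h : M.IsInvariant W) :
    Module.finrank k (M.sub W h).V + Module.finrank k (M.quot W h).V = Module.finrank k M.V := by
  rw [add_comm]
  exact W.finrank_quotient_add_finrank

/-- For the zero space this yields `[M] = [M] + [M]`, hence `[M] = 0`. -/
theorem isExtension_self_of_subsingleton (M : FinRep k A) [Subsingleton M.V] :
    IsExtension M M M :=
  ⟨0, 0, fun _ _ => Subsingleton.elim _ _, fun _ _ => Subsingleton.elim _ _,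
    fun _ _ _ => Subsingleton.elim _ _,
    fun x => ⟨fun _ => ⟨x, Subsingleton.elim _ _⟩, fun _ => Subsingleton.elim _ _⟩,
    fun x => ⟨x, Subsingleton.elim _ _⟩⟩

theorem cls_eq_zero (M : FinRep k A) (h : Module.finrank k M.V = 0) : M.cls = 0 := by
  have := Module.finrank_zero_iff.mp h
  simpa using M.isExtension_self_of_subsingleton.cls_eq

/-- Traces are additive on short exact sequences. -/
theorem IsExtension.trace_eq {M N P : FinRep k A} (h : IsExtension M N P) (a : A) :
    LinearMap.trace k N.V (N.ρ a) = LinearMap.trace k M.V (M.ρ a)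
      + LinearMap.trace k P.V (P.ρ a) := by
  obtain ⟨f, g, hf, hg, h1, h2, h3⟩ := h
  -- A linear splitting suffices, although it need not be equivariant: it writes the identity as `f
  -- ∘ r' + s ∘ g`, and cyclicity of the trace carries the two summands to `M` and `P`.
  obtain ⟨r, hr⟩ := f.exists_leftInverse_of_injective (LinearMap.ker_eq_bot.mpr h1)
  obtain ⟨s, hs⟩ := g.exists_rightInverse_of_surjective (LinearMap.range_eq_top.mpr h3)
  have hfr : ∀ x, f (r (x - s (g x))) = x - s (g x) := by
    intro x
    have : g (x - s (g x)) = 0 := by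
      rw [map_sub, sub_eq_zero]
      exact (LinearMap.congr_fun hs (g x)).symm
    obtain ⟨y, hy⟩ := (h2 _).mp this
    rw [← hy]
    exact congrArg f (LinearMap.congr_fun hr y)
  have hgf : ∀ y, g (f y) = 0 := fun y => (h2 _).mpr ⟨y, rfl⟩
  set r' : N.V →ₗ[k] M.V := r ∘ₗ (LinearMap.id - s ∘ₗ g) with hr'
  have e : N.ρ a = N.ρ a ∘ₗ (f ∘ₗ r') + N.ρ a ∘ₗ (s ∘ₗ g) := by
    ext x
    have := hfr x
    simp only [LinearMap.add_apply, LinearMap.comp_apply, hr', LinearMap.sub_apply,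
      LinearMap.id_apply]
    rw [this, ← map_add, sub_add_cancel]
  have e1 : r' ∘ₗ (N.ρ a ∘ₗ f) = M.ρ a := by
    ext y
    simp only [LinearMap.comp_apply, hr', LinearMap.sub_apply, LinearMap.id_apply]
    rw [← hf, hgf, map_zero, sub_zero]
    exact LinearMap.congr_fun hr _
  have e2 : g ∘ₗ (N.ρ a ∘ₗ s) = P.ρ a := by
    ext y
    simp only [LinearMap.comp_apply]
    rw [hg]
    exact congrArg _ (LinearMap.congr_fun hs y)
  conv_lhs => rw [e]
  rw [map_add, ← LinearMap.comp_assoc, LinearMap.trace_comp_comm', e1, ← LinearMap.comp_assoc,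
    LinearMap.trace_comp_comm', e2]

theorem IsEquivariant.isInvariant_ker {M N : FinRep k A} {f : M.V →ₗ[k] N.V}
    (h : IsEquivariant M N f) : M.IsInvariant (LinearMap.ker f) := fun a w hw => by
  rw [LinearMap.mem_ker] at *
  rw [h, hw, map_zero]

theorem IsEquivariant.isInvariant_range {M N : FinRep k A} {f : M.V →ₗ[k] N.V}
    (h : IsEquivariant M N f) : N.IsInvariant (LinearMap.range f) := by
  rintro a _ ⟨w, rfl⟩
  exact ⟨M.ρ a w, h a w⟩

/-- One half of Schur's lemma: the kernel is invariant, and it is not everything since `f ≠ 0`. -/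
theorem IsIrreducible.injective {M N : FinRep k A} (hM : M.IsIrreducible) {f : M.V →ₗ[k] N.V}
    (h : IsEquivariant M N f) (h0 : f ≠ 0) : Function.Injective f :=
  LinearMap.ker_eq_bot.mp
    ((hM.2 _ h.isInvariant_ker).resolve_right fun h1 => h0 (LinearMap.ker_eq_top.mp h1))

theorem IsIrreducible.surjective {M N : FinRep k A} (hN : N.IsIrreducible) {f : M.V →ₗ[k] N.V}
    (h : IsEquivariant M N f) (h0 : f ≠ 0) : Function.Surjective f :=
  LinearMap.range_eq_top.mp
    ((hN.2 _ h.isInvariant_range).resolve_left fun h1 => h0 (LinearMap.range_eq_bot.mp h1))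

theorem IsIsomorphic.symm {M N : FinRep k A} (h : IsIsomorphic M N) : IsIsomorphic N M := by
  obtain ⟨e, he⟩ := h
  refine ⟨e.symm, fun a v => e.injective ?_⟩
  have := he a (e.symm v)
  simp only [LinearEquiv.coe_coe, LinearEquiv.apply_symm_apply] at *
  rw [this]

theorem IsEquivariant.isIsomorphic {M N : FinRep k A} {f : M.V →ₗ[k] N.V}
    (h : IsEquivariant M N f) (hb : Function.Bijective f) : IsIsomorphic M N :=
  ⟨LinearEquiv.ofBijective f hb, h⟩

/-- The classes of irreducible representations generate the Grothendieck group. -/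
theorem cls_mem_of_irreducible (S : AddSubgroup (GrothendieckRing k A))
    (hS : ∀ M : FinRep k A, M.IsIrreducible → M.cls ∈ S) (M : FinRep k A) : M.cls ∈ S := by
  -- A nonzero reducible representation has a proper nonzero invariant subspace, so its class is a
  -- sum of two classes of smaller dimension.
  induction hn : Module.finrank k M.V using Nat.strong_induction_on generalizing M with
  | _ n ih =>
    rcases Nat.eq_zero_or_pos n with h0 | h0
    · rw [M.cls_eq_zero (hn.trans h0)]
      exact S.zero_mem
    by_cases hi : M.IsIrreducible
    · exact hS M hi
    have hnt : Nontrivial M.V := Module.finrank_pos_iff.mp (hn ▸ h0)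
    simp only [IsIrreducible, hnt, true_and] at hi
    push Not at hi
    obtain ⟨W, hW, hb, ht⟩ := hi
    have h1 := M.finrank_sub_add_quot W hW
    have h2 : 0 < Module.finrank k W := Nat.pos_of_ne_zero fun h => hb (Submodule.finrank_eq_zero.mp h)
    have h3 : Module.finrank k W < Module.finrank k M.V := Submodule.finrank_lt (lt_top_iff_ne_top.mpr ht).ne
    rw [M.cls_eq_sub_add_quot W hW]
    change Module.finrank k W + _ = _ at h1
    exact S.add_mem (ih _ (hn ▸ h3) _ rfl) (ih _ (by omega) _ rfl)

end FinRep

/-! ### Singular vectors and the subspaces they generate. -/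

namespace FinRep

section generators

variable {p : ℕ} (M N : FinRep ℂ (Uq p))

theorem isInvariant_of_generators {W : Submodule ℂ M.V} (hE : ∀ w ∈ W, M.ρ (Uq.E p) w ∈ W)
    (hF : ∀ w ∈ W, M.ρ (Uq.F p) w ∈ W) (hK : ∀ w ∈ W, M.ρ (Uq.K p) w ∈ W) :
    M.IsInvariant W := by
  intro a
  induction a using Uq.induction with
  | hc c =>
    intro w hw
    rw [AlgHom.commutes]
    exact W.smul_mem c hw
  | hadd a b ha hb =>
    intro w hw
    rw [map_add]
    exact W.add_mem (ha w hw) (hb w hw)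
  | hmul a b ha hb =>
    intro w hw
    rw [map_mul]
    exact ha _ (hb w hw)
  | hE => exact hE
  | hF => exact hF
  | hK => exact hK

variable {M N} in
theorem isEquivariant_of_generators {f : M.V →ₗ[ℂ] N.V}
    (hE : ∀ v, f (M.ρ (Uq.E p) v) = N.ρ (Uq.E p) (f v))
    (hF : ∀ v, f (M.ρ (Uq.F p) v) = N.ρ (Uq.F p) (f v))
    (hK : ∀ v, f (M.ρ (Uq.K p) v) = N.ρ (Uq.K p) (f v)) : IsEquivariant M N f := by
  intro a
  induction a using Uq.induction with
  | hc c => simp [Module.algebraMap_end_apply]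
  | hadd a b ha hb => simp [ha, hb]
  | hmul a b ha hb => simp [ha, hb]
  | hE => exact hE
  | hF => exact hF
  | hK => exact hK

theorem E_F_apply (v : M.V) : M.ρ (Uq.E p) (M.ρ (Uq.F p) v) = M.ρ (Uq.F p) (M.ρ (Uq.E p) v)
    + (q p - (q p)⁻¹)⁻¹ • (M.ρ (Uq.K p) v - M.ρ (Uq.Kinv p) v) := by
  have := congrArg (fun a => M.ρ a v) (Uq.E_mul_F p)
  simpa using this

theorem F_pow_zero_apply (v : M.V) : M.ρ (Uq.F p ^ 0) v = v := by simp

theorem F_pow_one_apply (v : M.V) : M.ρ (Uq.F p ^ 1) v = M.ρ (Uq.F p) v := by simp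

theorem F_pow_succ_apply (j : ℕ) (v : M.V) :
    M.ρ (Uq.F p ^ (j + 1)) v = M.ρ (Uq.F p) (M.ρ (Uq.F p ^ j) v) := by
  rw [pow_succ', map_mul]; rfl

theorem F_pow_add_apply (j l : ℕ) (v : M.V) :
    M.ρ (Uq.F p ^ (j + l)) v = M.ρ (Uq.F p ^ j) (M.ρ (Uq.F p ^ l) v) := by
  rw [pow_add, map_mul]; rfl

theorem F_pow_p_apply (v : M.V) : M.ρ (Uq.F p ^ p) v = 0 := by
  rw [(Uq.isTriple p).f_pow, map_zero]; rfl

theorem K_E_apply [p.AtLeastTwo] (v : M.V) :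
    M.ρ (Uq.K p) (M.ρ (Uq.E p) v) = q p ^ 2 • M.ρ (Uq.E p) (M.ρ (Uq.K p) v) := by
  have := congrArg (fun a => M.ρ a v) (Uq.K_mul_E p)
  simpa using this

theorem F_K_apply [p.AtLeastTwo] (v : M.V) :
    M.ρ (Uq.F p) (M.ρ (Uq.K p) v) = q p ^ 2 • M.ρ (Uq.K p) (M.ρ (Uq.F p) v) := by
  have := congrArg (fun a => M.ρ a v) (Uq.F_mul_K p)
  simpa using this

/-- The vector `v` is annihilated by `E` and has weight `α 𝔮^(s - 1)`. -/
structure IsSingular (α : ℤˣ) (s : ℤ) (v : M.V) : Prop where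
  E_apply : M.ρ (Uq.E p) v = 0
  K_apply : M.ρ (Uq.K p) v = (((α : ℤ) : ℂ) * q p ^ (s - 1)) • v

/-- The span of `v, F v, …, F^(n - 1) v`. -/
noncomputable def cyclicSpan (v : M.V) (n : ℕ) : Submodule ℂ M.V :=
  Submodule.span ℂ (Set.range fun j : Fin n => M.ρ (Uq.F p ^ (j : ℕ)) v)

variable {M}

theorem F_pow_mem_cyclicSpan (v : M.V) {n j : ℕ} (h : j < n) :
    M.ρ (Uq.F p ^ j) v ∈ M.cyclicSpan v n :=
  Submodule.subset_span ⟨⟨j, h⟩, rfl⟩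

theorem self_mem_cyclicSpan (v : M.V) {n : ℕ} (h : 0 < n) : v ∈ M.cyclicSpan v n := by
  simpa using F_pow_mem_cyclicSpan v h

theorem cyclicSpan_le {v : M.V} {n : ℕ} {W : Submodule ℂ M.V} :
    M.cyclicSpan v n ≤ W ↔ ∀ j < n, M.ρ (Uq.F p ^ j) v ∈ W := by
  rw [cyclicSpan, Submodule.span_le, Set.range_subset_iff]
  exact ⟨fun h j hj => h ⟨j, hj⟩, fun h j => h j j.2⟩

theorem finrank_cyclicSpan_le (v : M.V) (n : ℕ) : Module.finrank ℂ (M.cyclicSpan v n) ≤ n :=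
  (finrank_range_le_card (R := ℂ) fun j : Fin n => M.ρ (Uq.F p ^ (j : ℕ)) v).trans
    (Fintype.card_fin n).le

variable [hp : p.AtLeastTwo]

theorem Kinv_apply {α : ℤˣ} {m : ℤ} {v : M.V}
    (h : M.ρ (Uq.K p) v = (((α : ℤ) : ℂ) * q p ^ m) • v) :
    M.ρ (Uq.Kinv p) v = (((α : ℤ) : ℂ) * q p ^ (-m)) • v := by
  have h1 : M.ρ (Uq.Kinv p) (M.ρ (Uq.K p) v) = v := by
    have := congrArg (fun a => M.ρ a v) (Uq.Kinv_mul_K p)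
    simpa using this
  rw [h, map_smul] at h1
  conv_rhs => rw [← h1]
  rw [smul_smul, mul_mul_mul_comm, sign_sq, ← zpow_add₀ (q_ne_zero p), neg_add_cancel, zpow_zero,
    mul_one, one_smul]

theorem K_F_pow_apply {α : ℤˣ} {m : ℤ} {v : M.V}
    (h : M.ρ (Uq.K p) v = (((α : ℤ) : ℂ) * q p ^ m) • v) (j : ℕ) :
    M.ρ (Uq.K p) (M.ρ (Uq.F p ^ j) v)
      = (((α : ℤ) : ℂ) * q p ^ (m - 2 * j)) • M.ρ (Uq.F p ^ j) v := by
  have h0 := q_ne_zero p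
  induction j with
  | zero => simpa using h
  | succ j ih =>
    rw [F_pow_succ_apply]
    have h1 := M.F_K_apply (M.ρ (Uq.F p ^ j) v)
    rw [ih, map_smul] at h1
    rw [← inv_smul_eq_iff₀ (pow_ne_zero 2 h0)] at h1
    rw [← h1, smul_smul]
    congr 1
    have : m - 2 * (j : ℤ) = 2 + (m - 2 * ((j + 1 : ℕ) : ℤ)) := by push_cast; ring
    rw [this, zpow_add₀ h0, zpow_ofNat]
    field_simp

/-- Moving `E` past one `F` at a time adds a multiple of `K - K⁻¹` at each stage, and `qInt_rel`
telescopes the sum to a product of two quantum integers. For a positive integer `s` the coefficient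
vanishes at `j = s - 1`, so `F^s v` is again killed by `E`. -/
theorem IsSingular.E_F_pow_apply {α : ℤˣ} {s : ℤ} {v : M.V} (h : M.IsSingular α s v) (j : ℕ) :
    M.ρ (Uq.E p) (M.ρ (Uq.F p ^ (j + 1)) v)
      = (((α : ℤ) : ℂ) * qInt p (j + 1) * qInt p (s - 1 - j)) • M.ρ (Uq.F p ^ j) v := by
  -- The hypothesis concerns `F E F^j v` so that `j = 0`, where `E v = 0`, fits with `c = 0`.
  have key : ∀ (j : ℕ) (c : ℂ), c = ((α : ℤ) : ℂ) * qInt p j * qInt p (s - j) →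
      M.ρ (Uq.F p) (M.ρ (Uq.E p) (M.ρ (Uq.F p ^ j) v)) = c • M.ρ (Uq.F p ^ j) v →
      M.ρ (Uq.E p) (M.ρ (Uq.F p ^ (j + 1)) v)
      = (((α : ℤ) : ℂ) * qInt p (j + 1) * qInt p (s - 1 - j)) • M.ρ (Uq.F p ^ j) v := by
    intro j c hc h1
    have hK := K_F_pow_apply h.K_apply j
    rw [F_pow_succ_apply, E_F_apply, h1, hK, Kinv_apply hK, ← sub_smul, smul_smul, ← add_smul, hc]
    congr 1
    have := qInt_rel (p := p) j (s - j)
    rw [show s - j - 1 = s - 1 - (j : ℤ) by ring] at this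
    rw [show s - 1 - (j : ℤ) - j = s - 1 - 2 * j by ring] at this
    linear_combination -((α : ℤ) : ℂ) * this
  induction j with
  | zero => exact key 0 0 (by simp [qInt_zero]) (by simp [h.E_apply])
  | succ j ih =>
    refine key (j + 1) _ rfl ?_
    rw [ih, map_smul, ← F_pow_succ_apply]
    push_cast
    rw [show s - 1 - (j : ℤ) = s - (j + 1) by ring]

theorem IsSingular.isInvariant {α : ℤˣ} {s : ℤ} {v : M.V} (h : M.IsSingular α s v) {n : ℕ}
    (hn : M.ρ (Uq.F p ^ n) v = 0) : M.IsInvariant (M.cyclicSpan v n) := by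
  have key : ∀ f : Module.End ℂ M.V, (∀ j < n, f (M.ρ (Uq.F p ^ j) v) ∈ M.cyclicSpan v n) →
      ∀ w ∈ M.cyclicSpan v n, f w ∈ M.cyclicSpan v n := by
    intro f hf
    exact cyclicSpan_le (W := (M.cyclicSpan v n).comap f) |>.mpr hf
  apply isInvariant_of_generators <;> apply key <;> intro j hj
  · cases j with
    | zero => simp [h.E_apply]
    | succ j =>
      rw [h.E_F_pow_apply]
      exact Submodule.smul_mem _ _ (F_pow_mem_cyclicSpan v (by omega))
  · rw [← F_pow_succ_apply]
    rcases Nat.lt_or_ge (j + 1) n with h1 | h1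
    · exact F_pow_mem_cyclicSpan v h1
    · obtain rfl : j + 1 = n := by omega
      rw [hn]
      exact Submodule.zero_mem _
  · rw [K_F_pow_apply h.K_apply]
    exact Submodule.smul_mem _ _ (F_pow_mem_cyclicSpan v hj)

/-- A representation of dimension `n` with basis `v, F v, …, F^(n - 1) v`, where `v` is singular
of weight `α 𝔮^(s - 1)`. -/
structure IsHighestWeight (M : FinRep ℂ (Uq p)) (α : ℤˣ) (s : ℤ) (n : ℕ) (v : M.V) : Prop where
  singular : M.IsSingular α s v
  F_pow : M.ρ (Uq.F p ^ n) v = 0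
  span : M.cyclicSpan v n = ⊤
  finrank : Module.finrank ℂ M.V = n

/-- A representation generated by a singular vector `u` and a vector `w` that is singular modulo
the subrepresentation generated by `u`. -/
theorem exists_isHighestWeight_add {α β : ℤˣ} {s t : ℤ} {u w : M.V} {m n : ℕ}
    (hu : M.IsSingular α s u) (hum : M.ρ (Uq.F p ^ m) u = 0)
    (hE : M.ρ (Uq.E p) w ∈ M.cyclicSpan u m)
    (hK : M.ρ (Uq.K p) w = (((β : ℤ) : ℂ) * q p ^ (t - 1)) • w)
    (hF : M.ρ (Uq.F p ^ n) w ∈ M.cyclicSpan u m)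
    (hspan : M.cyclicSpan u m ⊔ M.cyclicSpan w n = ⊤) (hdim : Module.finrank ℂ M.V = m + n) :
    ∃ (A B : FinRep ℂ (Uq p)) (a : A.V) (b : B.V), A.IsHighestWeight α s m a ∧
      B.IsHighestWeight β t n b ∧ M.cls = A.cls + B.cls := by
  set W := M.cyclicSpan u m with hW
  have hi : M.IsInvariant W := hu.isInvariant hum
  -- Serves to get `u ∈ W`; the branch `j ≥ m` covers `m = 0`, where `hum` says that `u = 0`.
  have huW : ∀ j, M.ρ (Uq.F p ^ j) u ∈ W := by
    intro j
    rcases Nat.lt_or_ge j m with h | h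
    · exact F_pow_mem_cyclicSpan u h
    · obtain ⟨d, rfl⟩ := Nat.exists_eq_add_of_le h
      rw [add_comm, F_pow_add_apply, hum, map_zero]
      exact W.zero_mem
  have hu0 : u ∈ W := by simpa using huW 0
  have hinj := M.subι_injective W hi
  let a : (M.sub W hi).V := (⟨u, hu0⟩ : W)
  let b : (M.quot W hi).V := M.quotπ W hi w
  have hker : ∀ x ∈ W, M.quotπ W hi x = 0 := fun x hx => by
    rwa [← LinearMap.mem_ker, ker_quotπ]
  have hspA : (M.sub W hi).cyclicSpan a m = ⊤ := by
    apply Submodule.map_injective_of_injective hinj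
    rw [Submodule.map_top, range_subι, cyclicSpan, Submodule.map_span, ← Set.range_comp]
    rfl
  have hspB : (M.quot W hi).cyclicSpan b n = ⊤ := by
    have h1 : Submodule.map (M.quotπ W hi) (W ⊔ M.cyclicSpan w n) = ⊤ := by
      rw [hspan, Submodule.map_top, range_quotπ]
    have h2 : Submodule.map (M.quotπ W hi) W = ⊥ :=
      LinearMap.le_ker_iff_map.mp (M.ker_quotπ W hi).ge
    rw [Submodule.map_sup, h2, bot_sup_eq, cyclicSpan, Submodule.map_span, ← Set.range_comp] at h1
    exact h1
  -- The spanning families bound the two dimensions by `m` and `n`; as they add up to `m + n`, both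
  -- bounds are equalities.
  have hd := M.finrank_sub_add_quot W hi
  have hA : Module.finrank ℂ (M.sub W hi).V ≤ m := by
    rw [← finrank_top ℂ (M.sub W hi).V, ← hspA]
    exact finrank_cyclicSpan_le a m
  have hB : Module.finrank ℂ (M.quot W hi).V ≤ n := by
    rw [← finrank_top ℂ (M.quot W hi).V, ← hspB]
    exact finrank_cyclicSpan_le b n
  refine ⟨M.sub W hi, M.quot W hi, a, b, ⟨⟨hinj ?_, hinj ?_⟩, hinj ?_, hspA, by omega⟩,
    ⟨⟨?_, ?_⟩, ?_, hspB, by omega⟩, M.cls_eq_sub_add_quot W hi⟩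
  · exact hu.E_apply
  · exact hu.K_apply
  · exact hum
  · exact hker _ hE
  · change M.quotπ W hi (M.ρ (Uq.K p) w) = _
    rw [hK, map_smul]
  · exact hker _ hF

end generators

end FinRep

/-! ### Irreducibility of the `X^α(s)` and classification of the irreducible representations. -/

section irr

variable {p : ℕ}

theorem vec_apply {s n : ℕ} (h : n < s) (m : Fin s) : vec s n m = if (m : ℕ) = n then 1 else 0 := by
  rw [vec, dif_pos h, Pi.single_apply]
  congr 1
  simp [Fin.ext_iff]

theorem opE_apply (α : ℤˣ) {s m : ℕ} (h : m + 1 < s) (v : Fin s → ℂ) :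
    opE p α s v ⟨m, by omega⟩
      = ((α : ℤ) : ℂ) * qInt p (m + 1) * qInt p ((s : ℤ) - (m + 1)) * v ⟨m + 1, h⟩ := by
  have : LinearMap.proj (R := ℂ) (φ := fun _ : Fin s => ℂ) ⟨m, by omega⟩ ∘ₗ opE p α s
      = (((α : ℤ) : ℂ) * qInt p (m + 1) * qInt p ((s : ℤ) - (m + 1))) •
        LinearMap.proj (R := ℂ) (φ := fun _ : Fin s => ℂ) ⟨m + 1, h⟩ := by
    apply (Pi.basisFun ℂ (Fin s)).ext
    intro n
    have hv : Pi.basisFun ℂ (Fin s) n = vec s n := by simp [vec]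
    rw [hv, LinearMap.comp_apply, opE_vec α n.2]
    simp only [map_smul, LinearMap.smul_apply, LinearMap.proj_apply, smul_eq_mul]
    rw [vec_apply (by omega), vec_apply n.2]
    rcases n with ⟨_ | n, hn⟩
    · simp [qInt_zero]
    · by_cases hmn : m = n
      · subst hmn; simp
      · simp [hmn]
  exact LinearMap.congr_fun this v

variable [hp : p.AtLeastTwo]

/-- Vanishing means `𝔮^(2n) = 1`, and `𝔮²` is a primitive `p`-th root of unity. -/
theorem qInt_eq_zero_iff {n : ℤ} : qInt p n = 0 ↔ (p : ℤ) ∣ n := by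
  have h0 := q_ne_zero p
  have h1 : (q p ^ 2) ^ n = q p ^ n * q p ^ n := by
    rw [← zpow_natCast, ← zpow_mul, ← zpow_add₀ h0]
    congr 1
    push_cast; ring
  rw [qInt, div_eq_zero_iff, or_iff_left (q_sub_inv_ne_zero p), sub_eq_zero, zpow_neg,
    ← (q_sq_prim p).zpow_eq_one_iff_dvd, h1, mul_eq_one_iff_eq_inv₀ (zpow_ne_zero _ h0)]

theorem qInt_ne_zero {n : ℤ} (h0 : 0 < n) (h1 : n < p) : qInt p n ≠ 0 := fun h =>
  absurd (Int.le_of_dvd h0 (qInt_eq_zero_iff.mp h)) (not_le.mpr h1)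

theorem irr_E (i : Label p) : (irr i).ρ (Uq.E p) = opE p i.1 i.2.1 :=
  Uq.lift_E (isTriple_op i.1 i.2.2.2)
theorem irr_F (i : Label p) : (irr i).ρ (Uq.F p) = opF i.2.1 :=
  Uq.lift_F (isTriple_op i.1 i.2.2.2)
theorem irr_K (i : Label p) : (irr i).ρ (Uq.K p) = opK p i.1 i.2.1 :=
  Uq.lift_K (isTriple_op i.1 i.2.2.2)

theorem finrank_irr (i : Label p) : Module.finrank ℂ (irr i).V = i.2.1 := by
  change Module.finrank ℂ (Fin i.2.1 → ℂ) = _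
  simp

theorem irr_F_pow_vec (i : Label p) (j n : ℕ) :
    (irr i).ρ (Uq.F p ^ j) (vec i.2.1 n) = vec i.2.1 (n + j) := by
  rw [map_pow, irr_F]
  exact opF_pow_vec _ _ _

/-- By `opE_apply`, the `m`-th coordinate of `E v` is the `(m+1)`-st coordinate of `v` times `α
[m+1] [s-m-1]`. Both quantum integers are nonzero because `s ≤ p`, so the kernel of `E` is a line.
-/
theorem eq_smul_vec_of_opE_eq_zero (α : ℤˣ) {s : ℕ} (h0 : 0 < s) (hs : s ≤ p) {v : Fin s → ℂ}
    (h : opE p α s v = 0) : v = v ⟨0, h0⟩ • vec s 0 := by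
  have hα : ((α : ℤ) : ℂ) ≠ 0 := fun h => by simpa [h] using sign_sq α
  ext ⟨m, hm⟩
  rw [Pi.smul_apply, vec_apply h0]
  cases m with
  | zero => simp
  | succ m =>
    have h1 := opE_apply (p := p) α hm v
    rw [h] at h1
    have h2 := qInt_ne_zero (p := p) (n := m + 1) (by omega) (by omega)
    have h3 := qInt_ne_zero (p := p) (n := (s : ℤ) - (m + 1)) (by omega) (by omega)
    have := (mul_eq_zero.mp h1.symm).resolve_left (mul_ne_zero (mul_ne_zero hα h2) h3)
    simp [this]

variable (p) in
theorem q_pow_self : q p ^ p = -1 := by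
  have h2 := hp.prop
  have h1 : q p ^ p * q p ^ p = 1 := by rw [← pow_add, ← two_mul, q_pow_two_p]
  exact (mul_self_eq_one_iff.mp h1).resolve_left
    ((q_prim p).pow_ne_one_of_pos_of_lt (by omega) (by omega))

/-- Such a root is `𝔮^j` with `j < 2p`; when `j ≥ p`, the relation `𝔮^p = -1` trades the excess for
a sign. -/
theorem exists_label {z : ℂ} (hz : z ^ (2 * p) = 1) :
    ∃ i : Label p, z = ((i.1 : ℤ) : ℂ) * q p ^ ((i.2.1 : ℤ) - 1) := by
  have h2 := hp.prop
  have : NeZero (2 * p) := ⟨by omega⟩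
  obtain ⟨j, hj, rfl⟩ := (q_prim p).eq_pow_of_pow_eq_one hz
  rcases Nat.lt_or_ge j p with h | h
  · exact ⟨(1, ⟨j + 1, by constructor <;> omega⟩), by simp⟩
  · refine ⟨(-1, ⟨j - p + 1, by constructor <;> omega⟩), ?_⟩
    obtain ⟨d, rfl⟩ := Nat.exists_eq_add_of_le h
    simp [pow_add, q_pow_self]

namespace FinRep

variable {M : FinRep ℂ (Uq p)}

/-- `E` is nilpotent, so its kernel is nonzero. `K` preserves this kernel and has an eigenvector in
it, whose eigenvalue is a `2p`-th root of unity and hence comes from a label. -/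
theorem exists_isSingular [Nontrivial M.V] : ∃ (i : Label p) (v : M.V), v ≠ 0 ∧
    M.IsSingular i.1 i.2.1 v := by
  have hnil : (M.ρ (Uq.E p)) ^ p = 0 := by rw [← map_pow, (Uq.isTriple p).e_pow, map_zero]
  have hker : LinearMap.ker (M.ρ (Uq.E p)) ≠ ⊥ := by
    intro h
    have hi := LinearMap.ker_eq_bot.mp h
    obtain ⟨x, hx⟩ := exists_ne (0 : M.V)
    apply hx
    have h3 := (Module.End.coe_pow (M.ρ (Uq.E p)) p) ▸ hi.iterate p
    apply h3
    rw [hnil]; simp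
  have hK : ∀ x ∈ LinearMap.ker (M.ρ (Uq.E p)), M.ρ (Uq.K p) x ∈ LinearMap.ker (M.ρ (Uq.E p)) := by
    intro x hx
    have h1 := M.K_E_apply x
    rw [LinearMap.mem_ker] at *
    rw [hx, map_zero, eq_comm, smul_eq_zero] at h1
    exact h1.resolve_left (pow_ne_zero _ (q_ne_zero p))
  have : Nontrivial (LinearMap.ker (M.ρ (Uq.E p))) := Submodule.nontrivial_iff_ne_bot.mpr hker
  obtain ⟨z, hz⟩ := Module.End.exists_eigenvalue ((M.ρ (Uq.K p)).restrict hK)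
  obtain ⟨⟨v, hv⟩, hev⟩ := hz.exists_hasEigenvector
  have hv0 : v ≠ 0 := fun h => hev.2 (Subtype.ext h)
  have hKv : M.ρ (Uq.K p) v = z • v := congrArg Subtype.val hev.apply_eq_smul
  have hpow : ∀ j, M.ρ (Uq.K p ^ j) v = z ^ j • v := by
    intro j
    induction j with
    | zero => simp
    | succ j ih => rw [pow_succ', map_mul, Module.End.mul_apply, ih, map_smul, hKv, smul_smul,
        pow_succ]
  have hz1 : z ^ (2 * p) = 1 := by
    have h1 := hpow (2 * p)
    rw [(Uq.isTriple p).k_pow, map_one, Module.End.one_apply] at h1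
    have h2 : (z ^ (2 * p) - 1) • v = 0 := by rw [sub_smul, one_smul, ← h1, sub_self]
    exact sub_eq_zero.mp ((smul_eq_zero.mp h2).resolve_right hv0)
  obtain ⟨i, hi⟩ := exists_label hz1
  exact ⟨i, v, hv0, hv, by rw [hKv, hi]⟩

end FinRep

/-- A nonzero invariant subspace contains a singular vector, which must be a multiple of `v_0`, and
the powers of `F` carry `v_0` to the whole basis. -/
theorem irr_isIrreducible (i : Label p) : (irr i).IsIrreducible := by
  obtain ⟨α, s, hs⟩ := i
  have : Nonempty (Fin s) := ⟨⟨0, hs.1⟩⟩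
  set M : FinRep ℂ (Uq p) := irr (α, ⟨s, hs⟩) with hM
  refine ⟨inferInstanceAs (Nontrivial (Fin s → ℂ)), fun W hW => or_iff_not_imp_left.mpr fun hb => ?_⟩
  have : Nontrivial (M.sub W hW).V := Submodule.nontrivial_iff_ne_bot.mpr hb
  obtain ⟨j, v, hv0, hv⟩ := FinRep.exists_isSingular (M := M.sub W hW)
  let x : Fin s → ℂ := M.subι W hW v
  have hE : opE p α s x = 0 := by
    have h := M.subι_apply W hW (Uq.E p) v
    rw [hv.E_apply, map_zero] at h
    exact (LinearMap.congr_fun (irr_E (α, ⟨s, hs⟩)) x).symm.trans h.symm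
  have h1 := eq_smul_vec_of_opE_eq_zero α hs.1 hs.2 hE
  have h2 : x ⟨0, hs.1⟩ ≠ 0 := by
    intro h
    rw [h, zero_smul] at h1
    exact hv0 (M.subι_injective W hW (h1.trans (map_zero _).symm))
  have h3 : (vec s 0 : Fin s → ℂ) ∈ W := by
    refine (W.smul_mem_iff h2).mp ?_
    have h : x ∈ W := M.subι_mem W hW v
    rw [h1] at h
    exact h
  refine eq_top_iff.mpr ((Pi.basisFun ℂ (Fin s)).span_eq.symm.le.trans (Submodule.span_le.mpr ?_))
  rintro _ ⟨n, rfl⟩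
  have hv : Pi.basisFun ℂ (Fin s) n = vec s n := by simp [vec]
  have h4 := hW (Uq.F p ^ (n : ℕ)) _ h3
  have h5 : M.ρ (Uq.F p ^ (n : ℕ)) (vec s 0 : Fin s → ℂ) = (vec s (0 + n) : Fin s → ℂ) :=
    irr_F_pow_vec (α, ⟨s, hs⟩) n 0
  rw [h5, zero_add] at h4
  rw [hv]
  exact h4

namespace FinRep
variable {M : FinRep ℂ (Uq p)}

/-- A singular vector `v` of weight `α 𝔮^(s - 1)` with `F^s v = 0` defines a homomorphism from
`X^α(s)`. -/
theorem IsSingular.exists_hom {i : Label p} {v : M.V} (h : M.IsSingular i.1 i.2.1 v)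
    (hF : M.ρ (Uq.F p ^ i.2.1) v = 0) : ∃ f : (irr i).V →ₗ[ℂ] M.V,
      IsEquivariant (irr i) M f ∧ ∀ n < i.2.1, f (vec i.2.1 n) = M.ρ (Uq.F p ^ n) v := by
  obtain ⟨α, s, hs⟩ := i
  let f : (Fin s → ℂ) →ₗ[ℂ] M.V :=
    (Pi.basisFun ℂ (Fin s)).constr ℂ fun n => M.ρ (Uq.F p ^ (n : ℕ)) v
  have hf : ∀ n < s, f (vec s n) = M.ρ (Uq.F p ^ n) v := by
    intro n hn
    have := (Pi.basisFun ℂ (Fin s)).constr_basis ℂ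
      (fun n : Fin s => M.ρ (Uq.F p ^ (n : ℕ)) v) ⟨n, hn⟩
    simpa only [f, vec, hn, dif_pos, Pi.basisFun_apply] using this
  have key : ∀ g h : (Fin s → ℂ) →ₗ[ℂ] M.V, (∀ n < s, g (vec s n) = h (vec s n)) →
      ∀ x, g x = h x := by
    intro g h hgh
    refine LinearMap.congr_fun ((Pi.basisFun ℂ (Fin s)).ext fun n => ?_)
    simpa [vec, n.2] using hgh n n.2
  refine ⟨f, isEquivariant_of_generators ?_ ?_ ?_, hf⟩
  · rw [irr_E]
    refine key (f ∘ₗ opE p α s) (M.ρ (Uq.E p) ∘ₗ f) fun n hn => ?_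
    rw [LinearMap.comp_apply, LinearMap.comp_apply, opE_vec α hn, map_smul, hf _ (by omega), hf _ hn]
    cases n with
    | zero => simp [qInt_zero, h.E_apply]
    | succ n =>
      rw [h.E_F_pow_apply, Nat.add_sub_cancel]
      push_cast
      rw [show (s : ℤ) - (n + 1) = s - 1 - n by ring]
  · rw [irr_F]
    refine key (f ∘ₗ opF s) (M.ρ (Uq.F p) ∘ₗ f) fun n hn => ?_
    rw [LinearMap.comp_apply, LinearMap.comp_apply, opF_vec, hf _ hn, ← F_pow_succ_apply]
    rcases Nat.lt_or_ge (n + 1) s with h1 | h1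
    · exact hf _ h1
    · obtain rfl : n + 1 = s := by omega
      rw [vec_of_le le_rfl, map_zero]
      exact hF.symm
  · rw [irr_K]
    refine key (f ∘ₗ opK p α s) (M.ρ (Uq.K p) ∘ₗ f) fun n hn => ?_
    rw [LinearMap.comp_apply, LinearMap.comp_apply, opK_vec α hn, map_smul, hf _ hn,
      K_F_pow_apply h.K_apply]

/-- Every irreducible representation is isomorphic to some `X^α(s)`. -/
theorem IsIrreducible.exists_isIsomorphic (hM : M.IsIrreducible) :
    ∃ i : Label p, M.IsIsomorphic (irr i) := by
  have := hM.1
  obtain ⟨i, v, hv0, hv⟩ := exists_isSingular (M := M)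
  have hs : 1 ≤ (i.2 : ℕ) ∧ (i.2 : ℕ) ≤ p := i.2.2
  -- Otherwise `F^s v` is a nonzero singular vector, and by irreducibility the vectors `F^(s+j) v`
  -- span everything. Since `s ≥ 1`, this makes `F` surjective, which contradicts `F^p = 0` and `v ≠
  -- 0`.
  have hF : M.ρ (Uq.F p ^ i.2.1) v = 0 := by
    by_contra hne
    obtain ⟨s, hsi⟩ : ∃ s, s = (i.2 : ℕ) := ⟨_, rfl⟩
    rw [← hsi] at hne hs
    -- `F^s` lowers the weight exponent from `s - 1` to `-s - 1`, whence the label `-s`.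
    have hsing : M.IsSingular i.1 (-s) (M.ρ (Uq.F p ^ s) v) := by
      constructor
      · obtain ⟨m, hm⟩ : ∃ m, s = m + 1 := ⟨s - 1, by omega⟩
        rw [hm, hv.E_F_pow_apply]
        have : (i.2.1 : ℤ) - 1 - m = 0 := by omega
        rw [this, qInt_zero, mul_zero, zero_smul]
      · rw [K_F_pow_apply hv.K_apply, ← hsi]
        congr 3
        ring
    have hinv := hsing.isInvariant (M.F_pow_p_apply _)
    have hp0 : 0 < p := by omega
    have htop := (hM.2 _ hinv).resolve_left fun h => hne (by
      have := F_pow_mem_cyclicSpan (M.ρ (Uq.F p ^ s) v) hp0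
      rw [h] at this
      simpa using this)
    have hsurj : Function.Surjective (M.ρ (Uq.F p)) := by
      rw [← LinearMap.range_eq_top, eq_top_iff, ← htop, cyclicSpan_le]
      intro j _
      obtain ⟨m, hm⟩ : ∃ m, s = m + 1 := ⟨s - 1, by omega⟩
      rw [← F_pow_add_apply, hm, ← add_assoc, F_pow_succ_apply]
      exact ⟨_, rfl⟩
    obtain ⟨x, hx⟩ := (Module.End.coe_pow (M.ρ (Uq.F p)) p ▸ hsurj.iterate p) v
    apply hv0
    rw [← hx, ← map_pow, F_pow_p_apply]
  obtain ⟨f, hf, hfv⟩ := hv.exists_hom hF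
  have hf0 : f ≠ 0 := by
    rintro rfl
    have := hfv 0 hs.1
    rw [F_pow_zero_apply] at this
    exact hv0 this.symm
  exact ⟨i, (hf.isIsomorphic ⟨(irr_isIrreducible i).injective hf hf0,
    hM.surjective hf hf0⟩).symm⟩

/-- The homomorphism from `X^α(s)` hits the spanning family, and equality of dimensions makes it
bijective. Constituents of tensor products are identified in this way. -/
theorem IsHighestWeight.cls_eq {i : Label p} {v : M.V} (h : M.IsHighestWeight i.1 i.2.1 i.2.1 v) :
    M.cls = (irr i).cls := by
  obtain ⟨f, hf, hfv⟩ := h.singular.exists_hom h.F_pow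
  have hsurj : Function.Surjective f := by
    rw [← LinearMap.range_eq_top, eq_top_iff, ← h.span, cyclicSpan_le]
    intro j hj
    exact ⟨_, hfv j hj⟩
  have hinj : Function.Injective f :=
    (LinearMap.injective_iff_surjective_of_finrank_eq_finrank
      ((finrank_irr i).trans h.finrank.symm)).mpr hsurj
  exact (hf.isIsomorphic ⟨hinj, hsurj⟩).cls_eq.symm

end FinRep
end irr

/-! ### Linear independence of the irreducible classes, through traces. -/

section independence

variable {p : ℕ}

theorem opE_pow_vec_self [p.AtLeastTwo] (α : ℤˣ) {s : ℕ} (hs : s ≤ p) {n : ℕ} (hn : n < s) :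
    ∃ d : ℂ, d ≠ 0 ∧ (opE p α s ^ n) (vec s n) = d • vec s 0 := by
  have hα : ((α : ℤ) : ℂ) ≠ 0 := fun h => by simpa [h] using sign_sq α
  induction n with
  | zero => exact ⟨1, one_ne_zero, by simp⟩
  | succ n ih =>
    obtain ⟨d, hd, h⟩ := ih (by omega)
    have h1 : qInt p ((n + 1 : ℕ) : ℤ) ≠ 0 := qInt_ne_zero (by omega) (by omega)
    have h2 : qInt p ((s : ℤ) - (n + 1 : ℕ)) ≠ 0 := qInt_ne_zero (by omega) (by omega)
    refine ⟨_, mul_ne_zero (mul_ne_zero (mul_ne_zero hα h1) h2) hd, ?_⟩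
    rw [pow_succ, Module.End.mul_apply, opE_vec α hn, map_smul, Nat.add_sub_cancel, h, smul_smul]

theorem trace_eq_sum_vec {s : ℕ} (f : Module.End ℂ (Fin s → ℂ)) :
    LinearMap.trace ℂ (Fin s → ℂ) f = ∑ n : Fin s, f (vec s n) n := by
  rw [LinearMap.trace_eq_matrix_trace ℂ (Pi.basisFun ℂ (Fin s)), Matrix.trace]
  refine Finset.sum_congr rfl fun n _ => ?_
  rw [Matrix.diag_apply, LinearMap.toMatrix_apply]
  simp [vec]

variable [hp : p.AtLeastTwo]

/-- An element of the restricted quantum group whose trace in `X^β(t)` vanishes for `t < s`, and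
for `t = s` and `β ≠ α`, but not in `X^α(s)`, where `i = (α, s)`. -/
noncomputable def separator (i : Label p) : Uq p :=
  (1 + (((i.1 : ℤ) : ℂ) * q p ^ ((i.2.1 : ℤ) - 1)) • Uq.K p)
    * (Uq.F p ^ (i.2.1 - 1) * Uq.E p ^ (i.2.1 - 1))

theorem irr_separator_apply (i j : Label p) (v w : Fin j.2.1 → ℂ)
    (hw : (opF j.2.1 ^ (i.2.1 - 1)) ((opE p j.1 j.2.1 ^ (i.2.1 - 1)) v) = w) :
    (irr j).ρ (separator i) v
      = w + (((i.1 : ℤ) : ℂ) * q p ^ ((i.2.1 : ℤ) - 1)) • opK p j.1 j.2.1 w := by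
  change Uq.lift (isTriple_op j.1 j.2.2.2) (separator i) v = _
  simp only [separator, map_mul, map_add, map_one, map_smul, map_pow, Uq.lift_E, Uq.lift_F,
    Uq.lift_K, Module.End.mul_apply, LinearMap.add_apply, LinearMap.smul_apply,
    Module.End.one_apply, hw]

theorem irr_separator_vec (i j : Label p) {n : ℕ} (hn : n < (j.2 : ℕ)) (hni : n + 1 < i.2) :
    (irr j).ρ (separator i) (vec j.2.1 n) = 0 := by
  have h : (opE p j.1 j.2.1 ^ (i.2.1 - 1)) (vec j.2.1 n) = 0 := by
    obtain ⟨d, hd⟩ := Nat.exists_eq_add_of_le (show n + 1 ≤ i.2.1 - 1 by omega)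
    rw [hd, add_comm, pow_add, Module.End.mul_apply, opE_pow_vec j.1 n hn, map_zero]
  refine (irr_separator_apply i j _ 0 (by rw [h, map_zero])).trans ?_
  rw [map_zero, smul_zero, add_zero]
  rfl

/-- With `s` and `t` the dimensions of `i` and `j`: `E^(s-1)` already annihilates a representation
`X^β(t)` with `t < s`. -/
theorem trace_separator_of_lt {i j : Label p} (h : (j.2 : ℕ) < i.2) :
    LinearMap.trace ℂ _ ((irr j).ρ (separator i)) = 0 := by
  refine (trace_eq_sum_vec ((irr j).ρ (separator i))).trans (Finset.sum_eq_zero fun n _ => ?_)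
  have := irr_separator_vec i j n.2 (by have := n.2; omega)
  exact congrFun this n

/-- Only the last basis vector survives `E^(s-1)`, and `F^(s-1) E^(s-1)` multiplies it by some `d ≠
0`. There `K` acts by `β 𝔮^(-(s-1))`, so the first factor of `separator` contributes `1 + αβ`, which
is `2` for `β = α` and `0` for `β = -α`. -/
theorem exists_trace_separator (α : ℤˣ) (s : Set.Icc 1 p) : ∀ β : ℤˣ, ∃ d : ℂ, d ≠ 0 ∧
    LinearMap.trace ℂ _ ((irr (β, s)).ρ (separator (α, s)))
      = d * (1 + ((α : ℤ) : ℂ) * ((β : ℤ) : ℂ)) := by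
  intro β
  obtain ⟨s, hs⟩ := s
  obtain ⟨n, rfl⟩ : ∃ n, s = n + 1 := ⟨s - 1, by have := hs.1; omega⟩
  obtain ⟨d, hd, h⟩ := opE_pow_vec_self (p := p) β hs.2 (Nat.lt_succ_self n)
  refine ⟨d, hd, ?_⟩
  have h1 : (irr (β, ⟨n + 1, hs⟩)).ρ (separator (α, ⟨n + 1, hs⟩)) (vec (n + 1) n)
      = ((d * (1 + ((α : ℤ) : ℂ) * ((β : ℤ) : ℂ))) • vec (n + 1) n : Fin (n + 1) → ℂ) := by
    refine (irr_separator_apply (α, ⟨n + 1, hs⟩) (β, ⟨n + 1, hs⟩) _ (d • vec (n + 1) n) ?_).trans ?_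
    · change (opF (n + 1) ^ n) ((opE p β (n + 1) ^ n) (vec (n + 1) n)) = _
      rw [h, map_smul, opF_pow_vec, zero_add]
    have hc : (((α : ℤ) : ℂ) * q p ^ (((n + 1 : ℕ) : ℤ) - 1))
        * (((β : ℤ) : ℂ) * q p ^ (((n + 1 : ℕ) : ℤ) - 1 - 2 * n)) = ((α : ℤ) : ℂ) * β := by
      rw [mul_mul_mul_comm, ← zpow_add₀ (q_ne_zero p)]
      have : ((n + 1 : ℕ) : ℤ) - 1 + (((n + 1 : ℕ) : ℤ) - 1 - 2 * n) = 0 := by push_cast; ring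
      rw [this, zpow_zero, mul_one]
    change (d • vec (n + 1) n + (((α : ℤ) : ℂ) * q p ^ (((n + 1 : ℕ) : ℤ) - 1)) •
      opK p β (n + 1) (d • vec (n + 1) n) : Fin (n + 1) → ℂ) = _
    rw [map_smul, opK_vec β (Nat.lt_succ_self n), smul_comm d, smul_smul, hc]
    module
  refine (trace_eq_sum_vec ((irr (β, ⟨n + 1, hs⟩)).ρ (separator (α, ⟨n + 1, hs⟩)))).trans ?_
  refine (Fin.sum_univ_castSucc _).trans ?_
  rw [Finset.sum_eq_zero, zero_add]
  · refine (congrFun h1 (Fin.last n)).trans ?_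
    rw [Pi.smul_apply, vec_apply (Nat.lt_succ_self n)]
    simp
  · intro m _
    have := irr_separator_vec (α, ⟨n + 1, hs⟩) (β, ⟨n + 1, hs⟩) (n := m)
      (by have := m.2; change (m : ℕ) < n + 1; omega)
      (by have := m.2; change (m : ℕ) + 1 < n + 1; omega)
    exact congrFun this m.castSucc

/-- The trace of an element of the algebra, as a function on the Grothendieck group. -/
noncomputable def traceHom (a : Uq p) : GrothendieckRing ℂ (Uq p) →+ ℂ :=
  GrothendieckRing.lift (fun M => LinearMap.trace ℂ M.V (M.ρ a)) fun _ _ _ h => h.trace_eq a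

theorem linearIndependent_irr_cls :
    LinearIndependent ℤ fun i : Label p => (irr i).cls := by
  rw [linearIndependent_iff]
  intro l hl
  by_contra hne
  -- For a label of maximal dimension in the support, the trace of its `separator` kills every other
  -- term of the relation and leaves a nonzero multiple of one coefficient.
  obtain ⟨i, hi, hmax⟩ := Finset.exists_max_image l.support (fun i => (i.2 : ℕ))
    (Finsupp.support_nonempty_iff.mpr hne)
  have h := congrArg (traceHom (separator i)) hl
  rw [Finsupp.linearCombination_apply, Finsupp.sum, map_sum, map_zero, Finset.sum_eq_single i] at h
  · rw [map_zsmul, traceHom, GrothendieckRing.lift_cls, smul_eq_zero] at h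
    refine h.elim (Finsupp.mem_support_iff.mp hi) fun h => ?_
    obtain ⟨d, hd, hd1⟩ := exists_trace_separator i.1 i.2 i.1
    rw [hd1, sign_sq] at h
    exact mul_ne_zero hd (by norm_num) h
  · intro j hj hji
    rw [map_zsmul, traceHom, GrothendieckRing.lift_cls]
    rcases (hmax j hj).lt_or_eq with h1 | h1
    · rw [trace_separator_of_lt h1, smul_zero]
    · obtain ⟨β, t⟩ := j
      obtain ⟨α, s⟩ := i
      obtain rfl : t = s := Subtype.ext h1
      obtain ⟨d, hd, hd1⟩ := exists_trace_separator α t β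
      have hβ : β = -α := by
        rcases Int.units_eq_one_or α with rfl | rfl <;> rcases Int.units_eq_one_or β with rfl | rfl <;>
          simp_all
      rw [hd1, hβ, Units.val_neg, Int.cast_neg, mul_neg, sign_sq, add_neg_cancel, mul_zero, smul_zero]
  · exact fun h => absurd hi h

theorem span_irr_cls : Submodule.span ℤ (Set.range fun i : Label p => (irr i).cls) = ⊤ := by
  rw [eq_top_iff]
  intro x _
  induction x using GrothendieckRing.induction with
  | hcls M =>
    refine FinRep.cls_mem_of_irreducible
      (Submodule.span ℤ (Set.range fun i : Label p => (irr i).cls)).toAddSubgroup (fun M hM => ?_) M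
    obtain ⟨i, hi⟩ := hM.exists_isIsomorphic
    rw [hi.cls_eq]
    exact Submodule.subset_span ⟨i, rfl⟩
  | hneg x hx => exact Submodule.neg_mem _ (hx trivial)
  | hadd x y hx hy => exact Submodule.add_mem _ (hx trivial) (hy trivial)
  | h0 => exact Submodule.zero_mem _

/-- The basis of the Grothendieck ring by the classes of irreducible representations. -/
noncomputable def irrBasis : Module.Basis (Label p) ℤ (GrothendieckRing ℂ (Uq p)) :=
  Module.Basis.mk linearIndependent_irr_cls span_irr_cls.ge

theorem irrBasis_apply (i : Label p) : irrBasis i = (irr i).cls := Module.Basis.mk_apply _ _ i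

/-- Uniqueness comes from independence: isomorphic representations have equal classes, and distinct
labels have distinct classes. -/
theorem FinRep.IsIrreducible.existsUnique {M : FinRep ℂ (Uq p)} (hM : M.IsIrreducible) :
    ∃! i : Label p, M.IsIsomorphic (irr i) := by
  obtain ⟨i, hi⟩ := hM.exists_isIsomorphic
  refine ⟨i, hi, fun j hj => linearIndependent_irr_cls.injective ?_⟩
  rw [← hi.cls_eq, hj.cls_eq]

end independence

/-! ### Highest weight vectors, tensor products and the one-dimensional representations. -/

variable {p : ℕ} [hp : p.AtLeastTwo]

/-- The tensor product computations use `X^α(s)` only through this vector, never through the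
explicit model. -/
theorem exists_irr_isHighestWeight (i : Label p) :
    ∃ v, (irr i).IsHighestWeight i.1 i.2.1 i.2.1 v := by
  obtain ⟨α, s, hs⟩ := i
  refine ⟨(vec s 0 : Fin s → ℂ), ⟨?_, ?_⟩, ?_, ?_, finrank_irr _⟩
  · refine (LinearMap.congr_fun (irr_E (α, ⟨s, hs⟩)) _).trans ((opE_vec α hs.1).trans ?_)
    rw [Nat.cast_zero, qInt_zero, mul_zero, zero_mul, zero_smul]
    rfl
  · refine (LinearMap.congr_fun (irr_K (α, ⟨s, hs⟩)) _).trans ((opK_vec α hs.1).trans ?_)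
    rw [Nat.cast_zero, mul_zero, sub_zero]
    rfl
  · refine (irr_F_pow_vec (α, ⟨s, hs⟩) _ _).trans ?_
    rw [zero_add, vec_of_le le_rfl]
    rfl
  · refine eq_top_iff.mpr
      ((Pi.basisFun ℂ (Fin s)).span_eq.symm.le.trans (Submodule.span_le.mpr ?_))
    rintro _ ⟨n, rfl⟩
    have hv : Pi.basisFun ℂ (Fin s) n = vec s n := by simp [vec]
    have h1 := FinRep.F_pow_mem_cyclicSpan (M := irr (α, ⟨s, hs⟩)) (vec s 0 : Fin s → ℂ) n.2
    have h2 : (irr (α, ⟨s, hs⟩)).ρ (Uq.F p ^ (n : ℕ)) (vec s 0 : Fin s → ℂ)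
      = (vec s (0 + n) : Fin s → ℂ) := irr_F_pow_vec (α, ⟨s, hs⟩) n 0
    rw [h2, zero_add] at h1
    rw [hv]
    exact h1

theorem qInt_one : qInt p 1 = 1 := by
  rw [qInt, zpow_one, zpow_neg_one, div_self (q_sub_inv_ne_zero p)]

/-- The recursion that produces the coefficients in `tensor_F_pow_upper`. -/
theorem qInt_add_one (n : ℤ) : q p ^ (-n) + q p * qInt p n = qInt p (n + 1) := by
  have h0 := q_ne_zero p
  have h1 := q_sub_inv_ne_zero p
  have hn : q p ^ n ≠ 0 := zpow_ne_zero _ h0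
  rw [qInt, qInt, eq_div_iff h1, add_mul, mul_assoc, div_mul_cancel₀ _ h1, neg_add, zpow_add₀ h0,
    zpow_add₀ h0, zpow_neg, zpow_neg, zpow_one]
  field_simp
  ring

namespace FinRep

variable {M N : FinRep ℂ (Uq p)}

variable (M N) in
/-- Pure tensors, as elements of the tensor product representation. -/
noncomputable def tmul : M.V →ₗ[ℂ] N.V →ₗ[ℂ] (M.tensor N).V := TensorProduct.mk ℂ M.V N.V

theorem tensor_E_tmul (x : M.V) (y : N.V) : (M.tensor N).ρ (Uq.E p) (M.tmul N x y)
    = M.tmul N x (N.ρ (Uq.E p) y) + M.tmul N (M.ρ (Uq.E p) x) (N.ρ (Uq.K p) y) := by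
  change actTensor M.ρ N.ρ (Uq.E p) (x ⊗ₜ[ℂ] y) = _
  rw [actTensor_apply, Uq.comul_E, map_add, outer_tmul, outer_tmul, map_one]
  rfl

theorem tensor_F_tmul (x : M.V) (y : N.V) : (M.tensor N).ρ (Uq.F p) (M.tmul N x y)
    = M.tmul N (M.ρ (Uq.Kinv p) x) (N.ρ (Uq.F p) y) + M.tmul N (M.ρ (Uq.F p) x) y := by
  change actTensor M.ρ N.ρ (Uq.F p) (x ⊗ₜ[ℂ] y) = _
  rw [actTensor_apply, Uq.comul_F, map_add, outer_tmul, outer_tmul, map_one]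
  rfl

theorem tensor_K_tmul (x : M.V) (y : N.V) : (M.tensor N).ρ (Uq.K p) (M.tmul N x y)
    = M.tmul N (M.ρ (Uq.K p) x) (N.ρ (Uq.K p) y) := by
  change actTensor M.ρ N.ρ (Uq.K p) (x ⊗ₜ[ℂ] y) = _
  rw [actTensor_apply, Uq.comul_K, outer_tmul]
  rfl

theorem finrank_tensor : Module.finrank ℂ (M.tensor N).V
    = Module.finrank ℂ M.V * Module.finrank ℂ N.V := Module.finrank_tensorProduct ..

theorem tensor_eq_top {x : M.V} {y : N.V} {m n : ℕ} (hx : M.cyclicSpan x m = ⊤)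
    (hy : N.cyclicSpan y n = ⊤) {W : Submodule ℂ (M.tensor N).V}
    (h : ∀ i < m, ∀ j < n, M.tmul N (M.ρ (Uq.F p ^ i) x) (N.ρ (Uq.F p ^ j) y) ∈ W) : W = ⊤ := by
  have h1 : ∀ i < m, ∀ y', M.tmul N (M.ρ (Uq.F p ^ i) x) y' ∈ W := fun i hi y' => by
    have : N.cyclicSpan y n ≤ W.comap (M.tmul N (M.ρ (Uq.F p ^ i) x)) := cyclicSpan_le.mpr (h i hi)
    exact this (hy ▸ Submodule.mem_top)
  have h2 : ∀ x' y', M.tmul N x' y' ∈ W := fun x' y' => by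
    have : M.cyclicSpan x m ≤ W.comap ((M.tmul N).flip y') :=
      cyclicSpan_le.mpr fun i hi => h1 i hi y'
    exact this (hx ▸ Submodule.mem_top)
  rw [eq_top_iff]
  intro z _
  induction z using TensorProduct.induction_on with
  | zero => exact W.zero_mem
  | tmul x' y' => exact h2 x' y'
  | add a b ha hb => exact W.add_mem (ha True.intro) (hb True.intro)

/-- The representation of dimension `p` generated by a singular vector is an extension of two
irreducible ones. -/
theorem IsHighestWeight.cls_eq_add {α : ℤˣ} {s : ℕ} (h1 : 1 ≤ s) (h2 : s < p) {v : M.V}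
    (h : M.IsHighestWeight α s p v) : M.cls = (irr (α, ⟨s, h1, h2.le⟩)).cls
      + (irr (-α, ⟨p - s, by constructor <;> omega⟩)).cls := by
  -- `F^s v` is singular because `[s - s] = 0`, and `𝔮^p = -1` rewrites its weight `α 𝔮^(-s-1)` as
  -- `-α 𝔮^(p-s-1)`.
  have hu : M.IsSingular (-α) ((p - s : ℕ) : ℤ) (M.ρ (Uq.F p ^ s) v) := by
    constructor
    · obtain ⟨m, rfl⟩ : ∃ m, s = m + 1 := ⟨s - 1, by omega⟩
      have : ((m + 1 : ℕ) : ℤ) - 1 - m = 0 := by push_cast; ring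
      rw [h.singular.E_F_pow_apply, this, qInt_zero, mul_zero, zero_smul]
    · rw [K_F_pow_apply h.singular.K_apply]
      congr 1
      have hqp : q p ^ p = -1 := q_pow_self p
      have : (s : ℤ) - 1 - 2 * s = ((p - s : ℕ) : ℤ) - 1 - p := by push_cast [h2.le]; ring
      rw [this, zpow_sub₀ (q_ne_zero p), zpow_natCast, hqp]
      push_cast
      ring
  have hmem : M.ρ (Uq.F p ^ s) v ∈ M.cyclicSpan (M.ρ (Uq.F p ^ s) v) (p - s) :=
    self_mem_cyclicSpan _ (by omega)
  obtain ⟨A, B, a, b, hA, hB, hc⟩ := exists_isHighestWeight_add (m := p - s) (n := s) (w := v) hu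
    (by rw [← F_pow_add_apply, Nat.sub_add_cancel h2.le, h.F_pow])
    (by rw [h.singular.E_apply]; exact Submodule.zero_mem _) h.singular.K_apply hmem
    (by
      rw [eq_top_iff, ← h.span, cyclicSpan_le]
      intro j hj
      rcases Nat.lt_or_ge j s with h3 | h3
      · exact Submodule.mem_sup_right (F_pow_mem_cyclicSpan v h3)
      · apply Submodule.mem_sup_left
        obtain ⟨d, rfl⟩ := Nat.exists_eq_add_of_le h3
        rw [add_comm, F_pow_add_apply]
        exact F_pow_mem_cyclicSpan _ (by omega))
    (by rw [h.finrank]; omega)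
  rw [hc, add_comm, hA.cls_eq (i := (-α, ⟨p - s, by constructor <;> omega⟩)),
    hB.cls_eq (i := (α, ⟨s, h1, h2.le⟩))]

end FinRep

/-- The label `(1, 2)`. -/
def labelTwo (p : ℕ) [hp : p.AtLeastTwo] : Label p := (1, ⟨2, by decide, hp.prop⟩)

/-- The labels `(±1, 1)`. -/
def labelSign (p : ℕ) [hp : p.AtLeastTwo] (α : ℤˣ) : Label p :=
  (α, ⟨1, le_rfl, by have := hp.prop; omega⟩)

open FinRep

theorem irr_labelSign_one_cls : (irr (labelSign p 1)).cls = 1 := by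
  rw [GrothendieckRing.one_def, eq_comm]
  refine IsHighestWeight.cls_eq (M := FinRep.trivial ℂ (Uq p)) (i := labelSign p 1) (v := (1 : ℂ))
    ⟨⟨?_, ?_⟩, ?_, ?_, Module.finrank_self ℂ⟩
  · change Coalgebra.counit (R := ℂ) (Uq.E p) * (1 : ℂ) = 0
    rw [Uq.counit_E, zero_mul]
  · change Coalgebra.counit (R := ℂ) (Uq.K p) * (1 : ℂ)
      = ((((1 : ℤˣ) : ℤ) : ℂ) * q p ^ (((1 : ℕ) : ℤ) - 1)) * (1 : ℂ)
    rw [Uq.counit_K]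
    simp
  · refine (F_pow_one_apply (FinRep.trivial ℂ (Uq p)) _).trans ?_
    change Coalgebra.counit (R := ℂ) (Uq.F p) * (1 : ℂ) = 0
    rw [Uq.counit_F, zero_mul]
  · rw [eq_top_iff]
    intro (z : ℂ) _
    have h2 := Submodule.smul_mem _ z
      (self_mem_cyclicSpan (M := FinRep.trivial ℂ (Uq p)) (1 : ℂ) Nat.zero_lt_one)
    have h3 : (z • (1 : ℂ)) = z := mul_one z
    exact h3 ▸ h2

/-- `X^-(1) X^α(s) = X^(-α)(s)`. -/
theorem irr_labelSign_neg_one_mul (i : Label p) :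
    (irr (labelSign p (-1))).cls * (irr i).cls = (irr (-i.1, i.2)).cls := by
  obtain ⟨e, he⟩ := exists_irr_isHighestWeight (labelSign p (-1))
  obtain ⟨v, hv⟩ := exists_irr_isHighestWeight i
  rw [GrothendieckRing.cls_mul_cls]
  generalize irr (labelSign p (-1)) = X at *
  generalize irr i = N at *
  change X.IsHighestWeight (-1) ((1 : ℕ) : ℤ) 1 e at he
  have hKe : X.ρ (Uq.K p) e = (((((-1 : ℤˣ) : ℤ) : ℂ)) * q p ^ (0 : ℤ)) • e := by
    simpa using he.singular.K_apply
  have hKie := Kinv_apply hKe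
  simp only [Units.val_neg, Units.val_one, Int.cast_neg, Int.cast_one, neg_zero, zpow_zero, mul_one]
    at hKe hKie
  -- `F e = 0` and `K⁻¹ e = -e`, so `F` acts on `e ⊗ y` as `-1 ⊗ F`.
  have hF : ∀ j, (X.tensor N).ρ (Uq.F p ^ j) (X.tmul N e v)
      = (-1 : ℂ) ^ j • X.tmul N e (N.ρ (Uq.F p ^ j) v) := by
    intro j
    induction j with
    | zero => simp
    | succ j ih =>
      have h1 := he.F_pow
      rw [F_pow_one_apply] at h1
      rw [F_pow_succ_apply, ih, map_smul, tensor_F_tmul, h1, hKie, F_pow_succ_apply, map_zero,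
        LinearMap.zero_apply, add_zero, map_smul, LinearMap.smul_apply, smul_smul, pow_succ]
  refine IsHighestWeight.cls_eq (i := (-i.1, i.2)) (v := X.tmul N e v) ⟨⟨?_, ?_⟩, ?_, ?_, ?_⟩
  · rw [tensor_E_tmul, he.singular.E_apply, hv.singular.E_apply]
    simp
  · rw [tensor_K_tmul, hKe, hv.singular.K_apply]
    simp
  · rw [hF, hv.F_pow, map_zero, smul_zero]
  · refine tensor_eq_top he.span hv.span fun l hl j hj => ?_
    obtain rfl : l = 0 := by omega
    have h1 : X.tmul N (X.ρ (Uq.F p ^ 0) e) (N.ρ (Uq.F p ^ j) v)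
        = (-1 : ℂ) ^ j • (X.tensor N).ρ (Uq.F p ^ j) (X.tmul N e v) := by
      rw [hF, smul_smul, ← mul_pow, F_pow_zero_apply]
      simp
    rw [h1]
    exact Submodule.smul_mem _ _ (F_pow_mem_cyclicSpan _ hj)
  · rw [finrank_tensor, he.finrank, hv.finrank, one_mul]

/-! ### Tensor products with `X^+(2)`. -/

namespace FinRep
section two
variable {X N : FinRep ℂ (Uq p)} {a : X.V}

omit hp in
theorem IsHighestWeight.K_apply_one (ha : X.IsHighestWeight 1 2 2 a) :
    X.ρ (Uq.K p) a = q p • a := by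
  simpa using ha.singular.K_apply

theorem IsHighestWeight.E_F_apply_one (ha : X.IsHighestWeight 1 2 2 a) :
    X.ρ (Uq.E p) (X.ρ (Uq.F p) a) = a := by
  have h := ha.singular.E_F_pow_apply 0
  rw [zero_add, F_pow_one_apply, F_pow_zero_apply] at h
  rw [h]
  norm_num [qInt_one]

theorem IsHighestWeight.K_F_apply_one (ha : X.IsHighestWeight 1 2 2 a) :
    X.ρ (Uq.K p) (X.ρ (Uq.F p) a) = (q p)⁻¹ • X.ρ (Uq.F p) a := by
  have h := K_F_pow_apply ha.singular.K_apply 1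
  rw [F_pow_one_apply] at h
  rw [h]
  norm_num

theorem IsHighestWeight.Kinv_apply_one (ha : X.IsHighestWeight 1 2 2 a) :
    X.ρ (Uq.Kinv p) a = (q p)⁻¹ • a := by
  rw [Kinv_apply ha.singular.K_apply]
  norm_num

theorem IsHighestWeight.Kinv_F_apply_one (ha : X.IsHighestWeight 1 2 2 a) :
    X.ρ (Uq.Kinv p) (X.ρ (Uq.F p) a) = q p • X.ρ (Uq.F p) a := by
  have h := Kinv_apply (K_F_pow_apply ha.singular.K_apply 1)
  rw [F_pow_one_apply] at h
  rw [h]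
  norm_num

omit hp in
theorem IsHighestWeight.F_F_apply_one (ha : X.IsHighestWeight 1 2 2 a) :
    X.ρ (Uq.F p) (X.ρ (Uq.F p) a) = 0 := by
  rw [← F_pow_one_apply _ a, ← F_pow_succ_apply]
  exact ha.F_pow

/-- `F` kills `F a`, so only the term `K⁻¹ ⊗ F` of the coproduct contributes, and `K⁻¹` acts on `F
a` by `𝔮`. -/
theorem IsHighestWeight.tensor_F_pow_lower (ha : X.IsHighestWeight 1 2 2 a) (v : N.V) (j : ℕ) :
    (X.tensor N).ρ (Uq.F p ^ j) (X.tmul N (X.ρ (Uq.F p) a) v)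
      = q p ^ j • X.tmul N (X.ρ (Uq.F p) a) (N.ρ (Uq.F p ^ j) v) := by
  induction j with
  | zero => simp
  | succ j ih =>
    rw [F_pow_succ_apply, ih, map_smul, tensor_F_tmul, ha.Kinv_F_apply_one, ha.F_F_apply_one,
      F_pow_succ_apply, map_zero, LinearMap.zero_apply, add_zero, map_smul, LinearMap.smul_apply,
      smul_smul, pow_succ]

/-- Each further `F` multiplies the coefficient of the lower term by `𝔮` and adds the current power
of `𝔮⁻¹` from the upper term, which builds up a quantum integer. Its vanishing at `p` is what
separates the case `s = p` from `s < p`. -/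
theorem IsHighestWeight.tensor_F_pow_upper (ha : X.IsHighestWeight 1 2 2 a) (v : N.V) (j : ℕ) :
    (X.tensor N).ρ (Uq.F p ^ (j + 1)) (X.tmul N a v)
      = q p ^ (-(j + 1 : ℤ)) • X.tmul N a (N.ρ (Uq.F p ^ (j + 1)) v)
        + qInt p (j + 1) • X.tmul N (X.ρ (Uq.F p) a) (N.ρ (Uq.F p ^ j) v) := by
  induction j with
  | zero =>
    rw [zero_add, F_pow_one_apply, tensor_F_tmul, ha.Kinv_apply_one, F_pow_one_apply,
      F_pow_zero_apply]
    norm_num [qInt_one]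
  | succ j ih =>
    rw [F_pow_succ_apply _ (j + 1), ih, map_add, map_smul, map_smul, tensor_F_tmul, tensor_F_tmul,
      ha.Kinv_F_apply_one, ha.F_F_apply_one, ha.Kinv_apply_one, ← F_pow_succ_apply,
      ← F_pow_succ_apply, map_zero, LinearMap.zero_apply, add_zero, map_smul, LinearMap.smul_apply,
      map_smul, LinearMap.smul_apply, smul_add, smul_smul, smul_smul, add_assoc, ← add_smul]
    have h1 := qInt_add_one (p := p) (j + 1)
    have h2 : q p ^ (-(j + 1 : ℤ)) * (q p)⁻¹ = q p ^ (-(((j + 1 : ℕ) : ℤ) + 1)) := by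
      rw [← zpow_neg_one, ← zpow_add₀ (q_ne_zero p)]
      congr 1
    rw [h2, mul_comm (qInt p _), h1]
    push_cast
    rfl

/-- `E` takes `F a` back to `a`, so `F a ⊗ v` is singular modulo the subrepresentation generated by
`a ⊗ v`. -/
theorem IsHighestWeight.tensor_E_lower (ha : X.IsHighestWeight 1 2 2 a) {α : ℤˣ} {s : ℤ} {v : N.V}
    (hv : N.IsSingular α s v) : (X.tensor N).ρ (Uq.E p) (X.tmul N (X.ρ (Uq.F p) a) v)
      = (((α : ℤ) : ℂ) * q p ^ (s - 1)) • X.tmul N a v := by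
  rw [tensor_E_tmul, hv.E_apply, hv.K_apply, ha.E_F_apply_one, map_zero, zero_add, map_smul]

theorem IsHighestWeight.tensor_K_lower (ha : X.IsHighestWeight 1 2 2 a) {α : ℤˣ} {s : ℤ} {v : N.V}
    (hv : N.IsSingular α s v) : (X.tensor N).ρ (Uq.K p) (X.tmul N (X.ρ (Uq.F p) a) v)
      = (((α : ℤ) : ℂ) * q p ^ (s - 1 - 1)) • X.tmul N (X.ρ (Uq.F p) a) v := by
  rw [tensor_K_tmul, hv.K_apply, ha.K_F_apply_one, map_smul, map_smul, LinearMap.smul_apply,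
    smul_smul, zpow_sub_one₀ (q_ne_zero p) (s - 1), mul_assoc]

theorem IsHighestWeight.tensor_isSingular (ha : X.IsHighestWeight 1 2 2 a) {α : ℤˣ} {s : ℤ}
    {v : N.V} (hv : N.IsSingular α s v) : (X.tensor N).IsSingular α (s + 1) (X.tmul N a v) := by
  constructor
  · rw [tensor_E_tmul, hv.E_apply, ha.singular.E_apply]
    simp
  · rw [tensor_K_tmul, hv.K_apply, ha.K_apply_one, map_smul, map_smul, LinearMap.smul_apply,
      smul_smul, add_sub_right_comm, zpow_add_one₀ (q_ne_zero p), mul_assoc]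

/-- The tensor product with the two-dimensional representation `X^+(2)` is spanned by the
translates of two vectors. -/
theorem IsHighestWeight.tensor_span (ha : X.IsHighestWeight 1 2 2 a) {v : N.V} {s : ℕ}
    (hv : N.cyclicSpan v s = ⊤) {W : Submodule ℂ (X.tensor N).V}
    (h1 : ∀ j < s, (X.tensor N).ρ (Uq.F p ^ j) (X.tmul N a v) ∈ W)
    (h2 : ∀ j < s, X.tmul N (X.ρ (Uq.F p) a) (N.ρ (Uq.F p ^ j) v) ∈ W) : W = ⊤ := by
  refine tensor_eq_top ha.span hv fun i hi j hj => ?_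
  have : i = 0 ∨ i = 1 := by omega
  rcases this with rfl | rfl
  · rw [F_pow_zero_apply]
    cases j with
    | zero =>
      have := h1 0 hj
      rwa [F_pow_zero_apply] at this ⊢
    | succ j =>
      have h3 := h1 (j + 1) hj
      rw [ha.tensor_F_pow_upper] at h3
      -- The lower term of `F^(j+1) (a ⊗ v)` is in `W` by `h2`; what remains is `a ⊗ F^(j+1) v` with
      -- an invertible coefficient.
      have h4 := (W.add_mem_iff_left (W.smul_mem _ (h2 j (by omega)))).mp h3
      exact (W.smul_mem_iff (zpow_ne_zero _ (q_ne_zero p))).mp h4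
  · rw [F_pow_one_apply]
    exact h2 j hj

end two
end FinRep

/-- `X^+(2) X^α(s) = X^α(s + 1) + X^α(s - 1)` for `1 ≤ s < p`, where the last term is `0` for
`s = 1`. -/
theorem exists_irr_labelTwo_mul_of_lt (α : ℤˣ) {s : ℕ} (h1 : 1 ≤ s) (h2 : s < p) :
    ∃ (B : FinRep ℂ (Uq p)) (b : B.V), B.IsHighestWeight α ((s - 1 : ℕ) : ℤ) (s - 1) b ∧
      (irr (labelTwo p)).cls * (irr (α, ⟨s, h1, h2.le⟩)).cls
        = (irr (α, ⟨s + 1, by omega, h2⟩)).cls + B.cls := by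
  obtain ⟨a, ha⟩ := exists_irr_isHighestWeight (labelTwo p)
  obtain ⟨v, hv⟩ := exists_irr_isHighestWeight (p := p) (α, ⟨s, h1, h2.le⟩)
  rw [GrothendieckRing.cls_mul_cls]
  generalize irr (labelTwo p) = X at *
  generalize irr (α, ⟨s, h1, h2.le⟩) = N at *
  change X.IsHighestWeight 1 2 2 a at ha
  change N.IsHighestWeight α (s : ℤ) s v at hv
  -- The vectors `F a ⊗ F^j v` are reached from `F a ⊗ v`, except for `j = s - 1`, which already
  -- lies in the span of the translates of `a ⊗ v`. Hence the lengths `s + 1` and `s - 1`.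
  have hmem : ∀ j < s, X.tmul N (X.ρ (Uq.F p) a) (N.ρ (Uq.F p ^ j) v) ∈
      (X.tensor N).cyclicSpan (X.tmul N a v) (s + 1) ⊔
        (X.tensor N).cyclicSpan (X.tmul N (X.ρ (Uq.F p) a) v) (s - 1) ∧ (j + 1 = s →
      X.tmul N (X.ρ (Uq.F p) a) (N.ρ (Uq.F p ^ j) v) ∈
        (X.tensor N).cyclicSpan (X.tmul N a v) (s + 1)) := by
    intro j hj
    have h3 : j + 1 = s → X.tmul N (X.ρ (Uq.F p) a) (N.ρ (Uq.F p ^ j) v) ∈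
        (X.tensor N).cyclicSpan (X.tmul N a v) (s + 1) := by
      -- As `F^s v = 0`, one has `F^s (a ⊗ v) = [s] (F a ⊗ F^(s-1) v)`, and `[s] ≠ 0` because `0 < s
      -- < p`.
      rintro rfl
      have h := F_pow_mem_cyclicSpan (X.tmul N a v) (Nat.lt_succ_self (j + 1))
      rw [ha.tensor_F_pow_upper, hv.F_pow, map_zero, smul_zero, zero_add] at h
      exact (Submodule.smul_mem_iff _ (qInt_ne_zero (by omega) (by omega))).mp h
    refine ⟨?_, h3⟩
    rcases Nat.lt_or_ge (j + 1) s with h4 | h4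
    · apply Submodule.mem_sup_right
      have h := F_pow_mem_cyclicSpan (X.tmul N (X.ρ (Uq.F p) a) v) (n := s - 1) (j := j) (by omega)
      rw [ha.tensor_F_pow_lower] at h
      exact (Submodule.smul_mem_iff _ (pow_ne_zero _ (q_ne_zero p))).mp h
    · exact Submodule.mem_sup_left (h3 (by omega))
  have hspan := ha.tensor_span hv.span
    (fun j hj => Submodule.mem_sup_left (F_pow_mem_cyclicSpan (X.tmul N a v) (n := s + 1)
      (by omega))) fun j hj => (hmem j hj).1
  obtain ⟨A, B, u, w, hA, hB, hc⟩ := exists_isHighestWeight_add (t := ((s - 1 : ℕ) : ℤ)) (β := α)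
    (ha.tensor_isSingular hv.singular)
    (by rw [ha.tensor_F_pow_upper, F_pow_succ_apply, hv.F_pow]; simp)
    (by
      rw [ha.tensor_E_lower hv.singular]
      exact Submodule.smul_mem _ _ (self_mem_cyclicSpan _ (Nat.succ_pos s)))
    (by
      rw [ha.tensor_K_lower hv.singular]
      push_cast [h1]
      rfl)
    (by
      rw [ha.tensor_F_pow_lower]
      exact Submodule.smul_mem _ _ ((hmem (s - 1) (by omega)).2 (by omega)))
    hspan (by rw [finrank_tensor, ha.finrank, hv.finrank]; omega)
  -- The quotient is returned as a representation because its dimension `s - 1` may be `0`, for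
  -- which there is no label.
  refine ⟨B, w, hB, ?_⟩
  rw [hc, IsHighestWeight.cls_eq (i := (α, ⟨s + 1, by omega, h2⟩)) (v := u)]
  simpa using hA

theorem irr_labelTwo_mul_one (α : ℤˣ) : (irr (labelTwo p)).cls * (irr (labelSign p α)).cls
    = (irr (α, (labelTwo p).2)).cls := by
  obtain ⟨B, b, hB, h⟩ := exists_irr_labelTwo_mul_of_lt (p := p) α le_rfl hp.prop
  rw [B.cls_eq_zero hB.finrank, add_zero] at h
  exact h

theorem irr_labelTwo_mul_of_lt (α : ℤˣ) {s : ℕ} (h1 : 2 ≤ s) (h2 : s < p) :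
    (irr (labelTwo p)).cls * (irr (α, ⟨s, by omega, h2.le⟩)).cls
      = (irr (α, ⟨s + 1, by omega, h2⟩)).cls
        + (irr (α, ⟨s - 1, by constructor <;> omega⟩)).cls := by
  obtain ⟨B, b, hB, h⟩ := exists_irr_labelTwo_mul_of_lt (p := p) α (by omega : 1 ≤ s) h2
  rw [h, hB.cls_eq (i := (α, ⟨s - 1, by constructor <;> omega⟩))]

/-- `X^+(2) X^α(p) = 2 X^α(p - 1) + 2 X^(-α)(1)`. -/
theorem irr_labelTwo_mul_top (α : ℤˣ) :
    (irr (labelTwo p)).cls * (irr (α, ⟨p, by have := hp.prop; omega, le_rfl⟩)).cls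
      = 2 • (irr (α, ⟨p - 1, by have := hp.prop; constructor <;> omega⟩)).cls
        + 2 • (irr (labelSign p (-α))).cls := by
  have hp2 := hp.prop
  obtain ⟨a, ha⟩ := exists_irr_isHighestWeight (labelTwo p)
  obtain ⟨v, hv⟩ := exists_irr_isHighestWeight (p := p) (α, ⟨p, by omega, le_rfl⟩)
  rw [GrothendieckRing.cls_mul_cls]
  generalize irr (labelTwo p) = X at *
  generalize irr (α, ⟨p, by omega, le_rfl⟩) = N at *
  change X.IsHighestWeight 1 2 2 a at ha
  change N.IsHighestWeight α (p : ℤ) p v at hv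
  -- The weight of `a ⊗ v` is `α 𝔮^p = -α`, which belongs to the label `(-α, 1)`.
  have hu : (X.tensor N).IsSingular (-α) ((1 : ℕ) : ℤ) (X.tmul N a v) := by
    have h := ha.tensor_isSingular hv.singular
    refine ⟨h.E_apply, ?_⟩
    rw [h.K_apply, add_sub_cancel_right, zpow_natCast, q_pow_self]
    simp
  -- Since `F^p = 0`, the translates of `a ⊗ v` stop at length `p`; the other half of the dimension
  -- `2p` comes from all `p` translates of `F a ⊗ v`.
  have hspan : (X.tensor N).cyclicSpan (X.tmul N a v) p ⊔
      (X.tensor N).cyclicSpan (X.tmul N (X.ρ (Uq.F p) a) v) p = ⊤ := by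
    refine ha.tensor_span hv.span
      (fun j hj => Submodule.mem_sup_left (F_pow_mem_cyclicSpan _ hj)) fun j hj => ?_
    apply Submodule.mem_sup_right
    have h := F_pow_mem_cyclicSpan (X.tmul N (X.ρ (Uq.F p) a) v) hj
    rw [ha.tensor_F_pow_lower] at h
    exact (Submodule.smul_mem_iff _ (pow_ne_zero _ (q_ne_zero p))).mp h
  obtain ⟨A, B, u, w, hA, hB, hc⟩ := exists_isHighestWeight_add (t := ((p - 1 : ℕ) : ℤ)) (β := α)
    hu (F_pow_p_apply _ _)
    (by
      rw [ha.tensor_E_lower hv.singular]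
      exact Submodule.smul_mem _ _ (self_mem_cyclicSpan _ (by omega)))
    (by
      rw [ha.tensor_K_lower hv.singular]
      push_cast [show 1 ≤ p by omega]
      rfl)
    (by rw [F_pow_p_apply]; exact Submodule.zero_mem _)
    hspan (by rw [finrank_tensor, ha.finrank, hv.finrank]; omega)
  -- Both `p`-dimensional pieces have the constituents `X^(-α)(1)` and `X^α(p - 1)`, hence the
  -- factors `2`.
  have hA' := hA.cls_eq_add le_rfl (by omega)
  have hB' := hB.cls_eq_add (by omega) (by omega)
  have e : (⟨p - (p - 1), by constructor <;> omega⟩ : Set.Icc 1 p) = ⟨1, by constructor <;> omega⟩ :=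
    Subtype.ext (by change p - (p - 1) = 1; omega)
  rw [e] at hB'
  simp only [neg_neg] at hA'
  rw [hc, hA', hB', labelSign]
  abel

/-! ### The Chebyshev product formula and the indexing of fusion sums. -/

section Chebyshev

open Polynomial.Chebyshev in
/-- The product formula for Chebyshev polynomials of the second kind. -/
theorem chebyshev_S_mul_S (R : Type*) [CommRing R] (s : ℕ) (m : ℤ) :
    S R ((s : ℤ) - 1) * S R (m - 1) = ∑ k ∈ Finset.range s, S R (m - s + 2 * k) := by
  -- `X` times a summand is the sum of its two neighbours; subtracting the sum for `s` from `X`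
  -- times the one for `s + 1` leaves the sum for `s + 2`. Integer indices avoid any comparison of
  -- `s` with `m`.
  induction s using Nat.twoStepInduction with
  | zero => simp [S_neg_one]
  | one => simp
  | more s h0 h1 =>
    have e0 : S R (((s + 2 : ℕ) : ℤ) - 1)
        = Polynomial.X * S R (((s + 1 : ℕ) : ℤ) - 1) - S R ((s : ℤ) - 1) := by
      have := S_add_two R ((s : ℤ) - 1)
      push_cast
      rw [show (s : ℤ) + 2 - 1 = (s : ℤ) - 1 + 2 by ring, this]
      congr 3
      ring
    have e1 : ∀ k : ℕ, Polynomial.X * S R (m - ((s + 1 : ℕ) : ℤ) + 2 * k)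
        = S R (m - s + 2 * k) + S R (m - ((s + 2 : ℕ) : ℤ) + 2 * k) := by
      intro k
      have := S_add_one R (m - ((s + 1 : ℕ) : ℤ) + 2 * k)
      rw [eq_sub_iff_add_eq] at this
      rw [← this]
      congr 2 <;> push_cast <;> ring
    rw [e0, sub_mul, mul_assoc, h1, h0, Finset.mul_sum, Finset.sum_congr rfl fun k _ => e1 k,
      Finset.sum_add_distrib, Finset.sum_range_succ, Finset.sum_range_succ _ (s + 1)]
    rw [show m - ((s + 2 : ℕ) : ℤ) + 2 * ((s + 1 : ℕ) : ℤ) = m - s + 2 * s by push_cast; ring]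
    ring

end Chebyshev

/-- The substitution `t = d + 1 + 2k` passes from the index set of `fusionSum` to that of
`chebyshev_S_mul_S`, with `d = |s - s'|` and `m = min(s, s')`. -/
theorem sum_filter_modEq_two {G : Type*} [AddCommMonoid G] (f : ℕ → G) (d m : ℕ) :
    ∑ t ∈ (Finset.Icc (d + 1) (d + 2 * m - 1)).filter (fun t => t ≡ d + 1 [MOD 2]), f t
      = ∑ k ∈ Finset.range m, f (d + 1 + 2 * k) := by
  have hmem : ∀ t, t ∈ (Finset.Icc (d + 1) (d + 2 * m - 1)).filter (fun t => t ≡ d + 1 [MOD 2]) ↔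
      (d + 1 ≤ t ∧ t ≤ d + 2 * m - 1) ∧ t % 2 = (d + 1) % 2 := fun t => by
    rw [Finset.mem_filter, Finset.mem_Icc, Nat.ModEq]
  refine Finset.sum_nbij' (fun t => (t - (d + 1)) / 2) (fun k => d + 1 + 2 * k) ?_ ?_ ?_ ?_ ?_
  · intro t ht
    rw [hmem] at ht
    rw [Finset.mem_range]
    omega
  · intro k hk
    rw [Finset.mem_range] at hk
    rw [hmem]
    omega
  · intro t ht
    rw [hmem] at ht
    omega
  · intro k _
    omega
  · intro t ht
    rw [hmem] at ht
    congr 1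
    omega

theorem map_tilde {p : ℕ} {G H : Type*} [AddCommGroup G] [AddCommGroup H] (φ : G →+ H)
    (χ : Label p → G) (α : ℤˣ) (s : ℕ) : φ (tilde χ α s) = tilde (fun i => φ (χ i)) α s := by
  unfold tilde
  split_ifs
  · rfl
  · rw [map_add, map_nsmul]
  · exact map_zero φ

theorem map_fusionSum {p : ℕ} {G H : Type*} [AddCommGroup G] [AddCommGroup H] (φ : G →+ H)
    (χ : Label p → G) (i j : Label p) :
    φ (fusionSum χ i j) = fusionSum (fun i => φ (χ i)) i j := by
  rw [fusionSum, map_sum, fusionSum]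
  exact Finset.sum_congr rfl fun t _ => map_tilde φ χ _ t

/-! ### The Chebyshev recursion in the Grothendieck ring. -/

section recursion

variable (p)

/-- The class of `X^α(s)` for `1 ≤ s ≤ p`, and `0` for all other `s`. -/
noncomputable def irrCls (α : ℤˣ) (s : ℕ) : GrothendieckRing ℂ (Uq p) :=
  if h : 1 ≤ s ∧ s ≤ p then (irr (α, ⟨s, h⟩)).cls else 0

theorem irrCls_of_mem (α : ℤˣ) {s : ℕ} (h : 1 ≤ s ∧ s ≤ p) :
    irrCls p α s = (irr (α, ⟨s, h⟩)).cls := dif_pos h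

theorem irrCls_zero (α : ℤˣ) : irrCls p α 0 = 0 := dif_neg (by simp)

/-- The convention `irrCls p α 0 = 0` absorbs the exceptional case `s = 1`. -/
theorem irrCls_two_mul (α : ℤˣ) {s : ℕ} (h1 : 1 ≤ s) (h2 : s < p) :
    irrCls p 1 2 * irrCls p α s = irrCls p α (s + 1) + irrCls p α (s - 1) := by
  rw [irrCls_of_mem p 1 ⟨one_le_two, hp.prop⟩, irrCls_of_mem p α ⟨h1, h2.le⟩,
    irrCls_of_mem p α (s := s + 1) ⟨by omega, h2⟩]
  rcases h1.eq_or_lt with rfl | h3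
  · rw [Nat.sub_self, irrCls_zero, add_zero]
    exact irr_labelTwo_mul_one α
  · rw [irrCls_of_mem p α (s := s - 1) ⟨by omega, by omega⟩]
    exact irr_labelTwo_mul_of_lt α h3 h2

theorem irrCls_two_mul_top (α : ℤˣ) :
    irrCls p 1 2 * irrCls p α p = 2 • irrCls p α (p - 1) + 2 • irrCls p (-α) 1 := by
  have h := hp.prop
  rw [irrCls_of_mem p 1 ⟨one_le_two, hp.prop⟩, irrCls_of_mem p α (s := p) ⟨by omega, le_rfl⟩,
    irrCls_of_mem p α (s := p - 1) ⟨by omega, by omega⟩, irrCls_of_mem p (-α) ⟨le_rfl, by omega⟩]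
  exact irr_labelTwo_mul_top α

theorem irrCls_one_one : irrCls p 1 1 = 1 := by
  rw [irrCls_of_mem p 1 ⟨le_rfl, by have := hp.prop; omega⟩]
  exact irr_labelSign_one_cls

theorem irrCls_one_mul (α β : ℤˣ) (s : ℕ) : irrCls p α 1 * irrCls p β s = irrCls p (α * β) s := by
  rcases Int.units_eq_one_or α with rfl | rfl
  · rw [irrCls_one_one, one_mul, one_mul]
  by_cases h : 1 ≤ s ∧ s ≤ p
  · rw [irrCls_of_mem p _ h, irrCls_of_mem p _ h,
      irrCls_of_mem p _ ⟨le_rfl, by have := hp.prop; omega⟩, neg_one_mul]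
    exact irr_labelSign_neg_one_mul (β, ⟨s, h⟩)
  · rw [irrCls, irrCls, dif_neg h, irrCls, dif_neg h, mul_zero]

/-- The elements `χ̃^α(s)` for the classes of the irreducible representations. -/
noncomputable abbrev tildeCls (α : ℤˣ) (s : ℕ) : GrothendieckRing ℂ (Uq p) :=
  tilde (fun i : Label p => (irr i).cls) α s

theorem tildeCls_of_le (α : ℤˣ) {s : ℕ} (h : s ≤ p) : tildeCls p α s = irrCls p α s := by
  rcases Nat.eq_zero_or_pos s with rfl | h0
  · rw [irrCls_zero, tildeCls, tilde, dif_neg (by omega), dif_neg (by omega)]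
  · rw [irrCls_of_mem p α ⟨h0, h⟩, tildeCls, tilde, dif_pos ⟨h0, h⟩]

theorem tildeCls_add (α : ℤˣ) {m : ℕ} (h : m < p) :
    tildeCls p α (p + m) = irrCls p α (p - m) + 2 • irrCls p (-α) m := by
  rcases Nat.eq_zero_or_pos m with rfl | h0
  · rw [irrCls_zero, smul_zero, add_zero, add_zero, tildeCls_of_le p α le_rfl, Nat.sub_zero]
  · have e1 : 2 * p - (p + m) = p - m := by omega
    have e2 : p + m - p = m := by omega
    rw [tildeCls, tilde, dif_neg (by omega), dif_pos (by omega),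
      ← irrCls_of_mem p α (s := 2 * p - (p + m)) ⟨by omega, by omega⟩,
      ← irrCls_of_mem p (-α) (s := p + m - p) ⟨by omega, by omega⟩, e1, e2]

/-- The elements `χ̃` continue the recursion past `p`: at `s = p` it is `irrCls_two_mul_top`, and at
`s = p + m` it combines the recursions at `p - m` and, for the opposite sign, at `m`. -/
theorem irrCls_two_mul_tildeCls (α : ℤˣ) {s : ℕ} (h1 : 1 ≤ s) (h2 : s < 2 * p - 1) :
    irrCls p 1 2 * tildeCls p α s = tildeCls p α (s + 1) + tildeCls p α (s - 1) := by
  rcases lt_trichotomy s p with h | rfl | h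
  · rw [tildeCls_of_le p α h.le, tildeCls_of_le p α (s := s + 1) h,
      tildeCls_of_le p α (s := s - 1) (by omega), irrCls_two_mul p α h1 h]
  · have := hp.prop
    rw [tildeCls_of_le s α le_rfl, irrCls_two_mul_top, tildeCls_add s α (by omega),
      tildeCls_of_le s α (s := s - 1) (by omega)]
    abel
  · obtain ⟨m, rfl⟩ := Nat.exists_eq_add_of_le h.le
    have hm : p + m - 1 = p + (m - 1) := by omega
    rw [hm, add_assoc, tildeCls_add p α (by omega), tildeCls_add p α (by omega),
      tildeCls_add p α (by omega), mul_add, mul_smul_comm,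
      irrCls_two_mul p α (by omega) (by omega), irrCls_two_mul p (-α) (by omega) (by omega)]
    have h3 : p - (m - 1) = p - m + 1 := by omega
    rw [h3, Nat.sub_sub]
    abel

/-- The Chebyshev polynomials of the class of `X^+(2)`. -/
noncomputable def chebyshevCls (s : ℤ) : GrothendieckRing ℂ (Uq p) :=
  Polynomial.aeval (irrCls p 1 2) (Polynomial.Chebyshev.S ℤ (s - 1))

theorem chebyshevCls_zero : chebyshevCls p 0 = 0 := by
  simp [chebyshevCls]

theorem chebyshevCls_one : chebyshevCls p 1 = 1 := by
  simp [chebyshevCls]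

theorem chebyshevCls_add_one (s : ℤ) :
    chebyshevCls p (s + 1) = irrCls p 1 2 * chebyshevCls p s - chebyshevCls p (s - 1) := by
  have := Polynomial.Chebyshev.S_add_one ℤ (s - 1)
  rw [chebyshevCls, add_sub_right_comm, this, map_sub, map_mul, Polynomial.aeval_X]
  rfl

/-- The Grothendieck ring is not known to be commutative at this point. Both products of `X^α(1)`
and `X^+(2)` equal `X^α(2)`, and commutation extends to polynomials in `X^+(2)`. -/
theorem commute_chebyshevCls (α : ℤˣ) (s : ℤ) : Commute (irrCls p α 1) (chebyshevCls p s) := by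
  have h : Commute (irrCls p α 1) (irrCls p 1 2) := by
    rw [Commute, SemiconjBy, irrCls_one_mul, irrCls_two_mul p α le_rfl (by have := hp.prop; omega),
      irrCls_zero, add_zero, mul_one]
  rw [chebyshevCls]
  generalize Polynomial.Chebyshev.S ℤ (s - 1) = f
  induction f using Polynomial.induction_on' with
  | add f g hf hg => rw [map_add]; exact hf.add_right hg
  | monomial n c =>
    rw [Polynomial.aeval_monomial]
    exact (Algebra.commute_algebraMap_right c _).mul_right (h.pow_right n)

/-- Both sides satisfy the same two-step recursion and agree at `s = 0` and `s = 1`. -/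
theorem tildeCls_eq (α : ℤˣ) {s : ℕ} (h : s ≤ 2 * p - 1) :
    tildeCls p α s = chebyshevCls p s * irrCls p α 1 := by
  have h2 := hp.prop
  induction s using Nat.twoStepInduction with
  | zero => rw [tildeCls_of_le p α (Nat.zero_le p), irrCls_zero, Nat.cast_zero, chebyshevCls_zero,
      zero_mul]
  | one => rw [tildeCls_of_le p α (by omega), Nat.cast_one, chebyshevCls_one, one_mul]
  | more s h0 h1 =>
    have h3 := irrCls_two_mul_tildeCls p α (s := s + 1) (by omega) (by omega)
    rw [h1 (by omega), Nat.add_sub_cancel, h0 (by omega), ← sub_eq_iff_eq_add] at h3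
    rw [← h3, ← mul_assoc, ← sub_mul]
    have h4 := chebyshevCls_add_one p (s + 1)
    rw [add_sub_cancel_right] at h4
    push_cast
    rw [show (s : ℤ) + 2 = s + 1 + 1 by ring, h4]

theorem chebyshevCls_mul_comm (s t : ℤ) :
    chebyshevCls p s * chebyshevCls p t = chebyshevCls p t * chebyshevCls p s := by
  rw [chebyshevCls, chebyshevCls, ← map_mul, mul_comm, map_mul]

theorem chebyshevCls_mul (d m : ℕ) :
    chebyshevCls p m * chebyshevCls p (m + d : ℕ)
      = ∑ k ∈ Finset.range m, chebyshevCls p (d + 1 + 2 * k : ℕ) := by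
  rw [chebyshevCls, chebyshevCls, ← map_mul, chebyshev_S_mul_S, map_sum]
  refine Finset.sum_congr rfl fun k _ => ?_
  rw [chebyshevCls]
  congr 2
  push_cast
  ring

end recursion

/-! ### The fusion rules and the isomorphism. -/

/-- The classes of the irreducible representations multiply by the fusion rules. -/
theorem irr_cls_mul_irr_cls (i j : Label p) :
    (irr i).cls * (irr j).cls = fusionSum (fun l => (irr l).cls) i j := by
  obtain ⟨α, s, hs⟩ := i
  obtain ⟨β, t, ht⟩ := j
  have key : ∀ (α : ℤˣ) (s : ℕ) (hs : s ∈ Set.Icc 1 p), (irr (α, ⟨s, hs⟩)).cls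
      = chebyshevCls p s * irrCls p α 1 := fun α s hs => by
    rw [← tildeCls_eq p α (by have := hs.1; have := hs.2; omega), tildeCls_of_le p α hs.2,
      irrCls_of_mem p α hs]
  -- The bound, applied with `d + 2m = s + t`, keeps all indices `d + 1 + 2k` with `k < m` at most
  -- `2p - 1`, the range of `tildeCls_eq`.
  have hprod : ∀ d m : ℕ, d + 2 * m ≤ 2 * p →
      chebyshevCls p m * chebyshevCls p (m + d : ℕ) * irrCls p (α * β) 1
      = ∑ u ∈ (Finset.Icc (d + 1) (d + 2 * m - 1)).filter (fun u => u ≡ d + 1 [MOD 2]),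
          tildeCls p (α * β) u := by
    intro d m h
    rw [sum_filter_modEq_two, chebyshevCls_mul, Finset.sum_mul]
    refine Finset.sum_congr rfl fun k hk => (tildeCls_eq p _ ?_).symm
    have := Finset.mem_range.mp hk
    omega
  rw [key, key, mul_assoc, ← mul_assoc (irrCls p α 1), (commute_chebyshevCls p α t).eq, mul_assoc,
    irrCls_one_mul, ← mul_assoc]
  change _ = ∑ u ∈ (Finset.Icc (((s : ℤ) - (t : ℤ)).natAbs + 1) (s + t - 1)).filter
      (fun u => u ≡ ((s : ℤ) - (t : ℤ)).natAbs + 1 [MOD 2]), tildeCls p (α * β) u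
  have hs2 := hs.2
  have ht2 := ht.2
  rcases le_total s t with h | h
  · obtain ⟨d, rfl⟩ := Nat.exists_eq_add_of_le h
    have e1 : ((s : ℤ) - ((s + d : ℕ) : ℤ)).natAbs = d := by omega
    have e2 : s + (s + d) - 1 = d + 2 * s - 1 := by omega
    rw [e1, e2, hprod d s (by omega)]
  · obtain ⟨d, rfl⟩ := Nat.exists_eq_add_of_le h
    have e1 : (((t + d : ℕ) : ℤ) - (t : ℤ)).natAbs = d := by omega
    have e2 : t + d + t - 1 = d + 2 * t - 1 := by omega
    rw [e1, e2, chebyshevCls_mul_comm, hprod d t (by omega)]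

/-- The isomorphism of the fusion algebra with the Grothendieck group. -/
noncomputable def fusionEquiv (p : ℕ) [p.AtLeastTwo] :
    FusionAlgebra p ≃+ GrothendieckRing ℂ (Uq p) :=
  (irrBasis (p := p)).repr.symm.toAddEquiv

theorem fusionEquiv_χ (i : Label p) : fusionEquiv p (FusionAlgebra.χ i) = (irr i).cls := by
  rw [← irrBasis_apply]
  exact (irrBasis (p := p)).repr_symm_single_one i

/-- By biadditivity only basis elements matter; there the two fusion rules correspond, since
additive maps commute with `fusionSum`. -/
theorem fusionEquiv_mul (x y : FusionAlgebra p) :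
    fusionEquiv p (x * y) = fusionEquiv p x * fusionEquiv p y := by
  have hχ : ∀ i j : Label p, fusionEquiv p (FusionAlgebra.χ i * FusionAlgebra.χ j)
      = fusionEquiv p (FusionAlgebra.χ i) * fusionEquiv p (FusionAlgebra.χ j) := by
    intro i j
    rw [FusionAlgebra.χ_mul_χ, fusionEquiv_χ, fusionEquiv_χ, irr_cls_mul_irr_cls]
    refine (map_fusionSum (fusionEquiv p).toAddMonoidHom FusionAlgebra.χ i j).trans ?_
    congr 1
    funext l
    exact fusionEquiv_χ l
  have hind : ∀ (C : FusionAlgebra p → Prop), C 0 → (∀ a b, C a → C b → C (a + b)) →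
      (∀ (c : ℤ) (i : Label p), C (c • FusionAlgebra.χ i)) → ∀ x, C x := by
    intro C h0 hadd hs x
    refine Finsupp.induction_linear (motive := C) x h0 hadd fun i c => ?_
    have e : (Finsupp.single i c : Label p →₀ ℤ) = c • Finsupp.single i (1 : ℤ) := by simp
    rw [e]
    exact hs c i
  refine hind (fun x => fusionEquiv p (x * y) = fusionEquiv p x * fusionEquiv p y) (by simp)
    (fun a b ha hb => by rw [add_mul, map_add, ha, hb, map_add, add_mul])
    (fun c i => ?_) x
  refine hind (fun y => fusionEquiv p (_ * y) = fusionEquiv p _ * fusionEquiv p y) (by simp)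
    (fun a b ha hb => by rw [mul_add, map_add, ha, hb, map_add, mul_add])
    (fun d j => ?_) y
  simp only [smul_mul_assoc, mul_smul_comm, map_zsmul, hχ]

end RestrictedQuantum

/-- The irreducible representations of `Ū_𝔮 sl(2)` are exactly the `X^α(s)`, their classes form a
`ℤ`-basis of the Grothendieck ring, these classes multiply by the stated formula, and the
Grothendieck ring is isomorphic to the `(1,p)` fusion algebra through an isomorphism that
matches the preferred bases. -/
theorem theorem1p2 (p : ℕ) [p.AtLeastTwo] :
    (∀ i : Label p, (irr i).IsIrreducible) ∧
    (∀ M : FinRep ℂ (Uq p), M.IsIrreducible → ∃! i : Label p, M.IsIsomorphic (irr i)) ∧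
    (∃ b : Module.Basis (Label p) ℤ (GrothendieckRing ℂ (Uq p)), ∀ i, b i = (irr i).cls) ∧
    (∀ i j : Label p, (irr i).cls * (irr j).cls = fusionSum (fun l => (irr l).cls) i j) ∧
    (∃ e : FusionAlgebra p ≃+* GrothendieckRing ℂ (Uq p),
      ∀ i, e (FusionAlgebra.χ i) = (irr i).cls) :=
  ⟨irr_isIrreducible, fun _ hM => hM.existsUnique, ⟨irrBasis, irrBasis_apply⟩,
    irr_cls_mul_irr_cls, ⟨{ fusionEquiv p with map_mul' := fusionEquiv_mul }, fusionEquiv_χ⟩⟩
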